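/- Let $M$ be a smooth manifold (finite-dimensional, Hausdorff, $\sigma$-compact, without boundary) and let $A\to M$ be a Lie algebroid of finite rank, with anchor $\rho\colon A\to TM$ and bracket $[\cdot,\cdot]$. Let $F_M\subseteq TM$ be an involutive smooth subbundle and let $J\subseteq A$ be a Lie subalgebroid over $M$ (a smooth subbundle with $\Gamma(J)$ closed under the bracket) such that $\rho(J)\subseteq F_M$. For $a\in\Gamma(A)$ write $\bar a\in\Gamma(A/J)$ for its class, and let \[\nabla^J\colon\Gamma(J)\times\Gamma(A/J)\to\Gamma(A/J),\qquad \nabla^J_j\bar a=\overline{[j,a]},\] be the Bott connection. Let $\nabla\colon\Gamma(F_M)\times\Gamma(A/J)\to\Gamma(A/J)$ be a flat linear $F_M$-connection on $A/J$. Brackets and $\nabla$ are local, so they are also defined for smooth sections over open subsets of $M$; a smooth section $a$ of $A$ over an open set $U\subseteq M$ is called $\nabla$-parallel if $\nabla_X\bar a=0$ on $U$ for all smooth sections $X$ of $F_M$ over $U$. Then the following are equivalent. \begin{enumerate} \item[(iis1)] For every open set $U\subseteq M$, every $\nabla$-parallel smooth section $a$ of $A$ over $U$ and every smooth section $j$ of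 $J$ over $U$, the bracket $[a,j]$ is a section of $J$ over $U$. \item[(iis1')] $\nabla^J_j\bar a=\nabla_{\rho(j)}\bar a$ for all $j\in\Gamma(J)$ and all $a\in\Gamma(A)$. \end{enumerate} -/

import Mathlib

open Set Filter Topology
open scoped Manifold ContDiff Bundle

namespace LieAlgd

noncomputable section

variable {E : Type*} [NormedAddCommGroup E] [NormedSpace ℝ E]
  {M : Type*} [TopologicalSpace M] [ChartedSpace E M]
  {F : Type*} [NormedAddCommGroup F] [NormedSpace ℝ F]
  {V : M → Type*} [TopologicalSpace (Bundle.TotalSpace F V)]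
  [∀ x, TopologicalSpace (V x)] [∀ x, AddCommGroup (V x)] [∀ x, Module ℝ (V x)]
  [FiberBundle F V] [VectorBundle ℝ F V]

/-! ### Smooth sections of vector bundles, subbundles and quotient bundles -/

variable (E F V) in
/-- Global smooth sections of the vector bundle `V` with typical fibre `F` over the
manifold `M` modelled on `E`. -/
abbrev Sec := ContMDiffSection 𝓘(ℝ, E) F ∞ V

variable (E M) in
/-- Smooth vector fields on `M`. -/
abbrev VectorField [IsManifold 𝓘(ℝ, E) ∞ M] :=
  Sec E E (fun x : M => TangentSpace 𝓘(ℝ, E) x)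

variable (E F) in
/-- `s` is a smooth section of `V` over the set `U` (its values outside `U` are irrelevant). -/
def IsSmoothOn (U : Set M) (s : ∀ x, V x) : Prop :=
  ContMDiffOn 𝓘(ℝ, E) (𝓘(ℝ, E).prod 𝓘(ℝ, F)) ∞ (fun x => Bundle.TotalSpace.mk' F x (s x)) U

/-- The product of a smooth function and a smooth section. -/
def fsmul (f : C^∞⟮𝓘(ℝ, E), M; ℝ⟯) (s : Sec E F V) : Sec E F V :=
  ⟨fun x => f x • s x, f.contMDiff.smul_section s.contMDiff⟩

@[simp] theorem fsmul_apply (f : C^∞⟮𝓘(ℝ, E), M; ℝ⟯) (s : Sec E F V) (x : M) :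
    fsmul f s x = f x • s x := rfl

variable (E F) in
/-- A family of subspaces of the fibres is a smooth subbundle if near every point it is spanned
by finitely many smooth sections that are pointwise linearly independent. -/
def IsSubbundle (J : ∀ x, Submodule ℝ (V x)) : Prop :=
  ∀ x₀ : M, ∃ U : Set M, IsOpen U ∧ x₀ ∈ U ∧ ∃ (k : ℕ) (s : Fin k → ∀ x, V x),
    (∀ i, IsSmoothOn E F U (s i)) ∧
    ∀ x ∈ U, LinearIndependent ℝ (fun i => s i x) ∧
      Submodule.span ℝ (range fun i => s i x) = J x

variable (E F) in
/-- `Γ(J)`: the global smooth sections with values in the subbundle `J`. -/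
def secIn (J : ∀ x, Submodule ℝ (V x)) : Submodule ℝ (Sec E F V) where
  carrier := {s | ∀ x, s x ∈ J x}
  add_mem' hs ht x := (J x).add_mem (hs x) (ht x)
  zero_mem' x := (J x).zero_mem
  smul_mem' c _ hs x := (J x).smul_mem c (hs x)

/-- The product of a smooth function and a section of the subbundle `J`. -/
def fsmulIn {J : ∀ x, Submodule ℝ (V x)} (f : C^∞⟮𝓘(ℝ, E), M; ℝ⟯) (s : secIn E F J) :
    secIn E F J :=
  ⟨fsmul f s.1, fun x => (J x).smul_mem (f x) (s.2 x)⟩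

variable (E F) in
/-- `Γ(V/J)`: the global smooth sections of the quotient bundle with fibres `V x ⧸ J x`, that is,
the families of classes which near every point are represented by a smooth section of `V`. -/
def quotSec (J : ∀ x, Submodule ℝ (V x)) : Submodule ℝ (∀ x, V x ⧸ J x) where
  carrier := {σ | ∀ x₀ : M, ∃ U : Set M, IsOpen U ∧ x₀ ∈ U ∧ ∃ a : ∀ x, V x,
    IsSmoothOn E F U a ∧ ∀ x ∈ U, σ x = (J x).mkQ (a x)}
  add_mem' {σ τ} hσ hτ x₀ := by
    obtain ⟨U, hU, hxU, a, ha, haσ⟩ := hσ x₀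
    obtain ⟨W, hW, hxW, b, hb, hbτ⟩ := hτ x₀
    refine ⟨U ∩ W, hU.inter hW, ⟨hxU, hxW⟩, a + b,
      (ContMDiffOn.mono ha inter_subset_left).add_section
        (ContMDiffOn.mono hb inter_subset_right), fun x hx => ?_⟩
    simp [haσ x hx.1, hbτ x hx.2]
  zero_mem' x₀ := ⟨univ, isOpen_univ, mem_univ _, fun x => (0 : Sec E F V) x,
    (0 : Sec E F V).contMDiff.contMDiffOn, fun x _ => by simp⟩
  smul_mem' c σ hσ x₀ := by
    obtain ⟨U, hU, hxU, a, ha, haσ⟩ := hσ x₀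
    refine ⟨U, hU, hxU, c • a, ContMDiffOn.const_smul_section ha, fun x hx => ?_⟩
    simp [haσ x hx]

/-- The product of a smooth function and a section of the quotient bundle. -/
def fsmulQuot {J : ∀ x, Submodule ℝ (V x)} (f : C^∞⟮𝓘(ℝ, E), M; ℝ⟯) (σ : quotSec E F J) :
    quotSec E F J :=
  ⟨fun x => f x • σ.1 x, fun x₀ => by
    obtain ⟨U, hU, hxU, a, ha, haσ⟩ := σ.2 x₀
    refine ⟨U, hU, hxU, (f : M → ℝ) • a,
      ContMDiffOn.smul_section f.contMDiff.contMDiffOn ha, fun x hx => ?_⟩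
    simp [haσ x hx]⟩

/-- The class `ā ∈ Γ(V/J)` of a section `a ∈ Γ(V)`. -/
def quotMk (J : ∀ x, Submodule ℝ (V x)) : Sec E F V →ₗ[ℝ] quotSec E F J where
  toFun a := ⟨fun x => (J x).mkQ (a x), fun _ =>
    ⟨univ, isOpen_univ, mem_univ _, a, a.contMDiff.contMDiffOn, fun _ _ => rfl⟩⟩
  map_add' a b := by ext x; simp
  map_smul' c a := by ext x; simp

@[simp] theorem quotMk_apply (J : ∀ x, Submodule ℝ (V x)) (a : Sec E F V) (x : M) :
    (quotMk J a).1 x = (J x).mkQ (a x) := rfl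

/-! ### Cut-off functions, germs and lifts -/

section Cutoff

variable [FiniteDimensional ℝ E] [T2Space M] [IsManifold 𝓘(ℝ, E) ∞ M]

theorem exists_cutoff {U : Set M} {x : M} (hU : U ∈ 𝓝 x) :
    ∃ f : C^∞⟮𝓘(ℝ, E), M; ℝ⟯, f =ᶠ[𝓝 x] (1 : M → ℝ) ∧ tsupport f ⊆ U := by
  obtain ⟨f, -, hf⟩ := (SmoothBumpFunction.nhds_basis_tsupport (I := 𝓘(ℝ, E)) x).mem_iff.1 hU
  exact ⟨⟨f, f.contMDiff⟩, f.eventuallyEq_one, hf⟩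

/-- Every smooth section over an open set has near each point of it the same germ as some
global smooth section, which may be taken to be a pointwise multiple of the given one. -/
theorem exists_germ {U : Set M} (hU : IsOpen U) {s : ∀ x, V x} (hs : IsSmoothOn E F U s)
    {x : M} (hx : x ∈ U) :
    ∃ t : Sec E F V, (∀ᶠ y in 𝓝 x, t y = s y) ∧ ∀ y, ∃ c : ℝ, (y ∉ U → c = 0) ∧ t y = c • s y := by
  obtain ⟨f, hf1, hfU⟩ := exists_cutoff (E := E) (hU.mem_nhds hx)
  refine ⟨⟨(f : M → ℝ) • s, ContMDiffOn.smul_section_of_tsupport f.contMDiff.contMDiffOn hU hfU hs⟩,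
    hf1.mono fun y hy => ?_, fun y => ⟨f y, fun hy => ?_, rfl⟩⟩
  · change f y • s y = s y
    rw [hy]; simp
  · exact image_eq_zero_of_notMem_tsupport fun h => hy (hfU h)

variable [SigmaCompactSpace M]

/-- Every global section of the quotient bundle is the class of a global section. -/
theorem quotMk_surjective (J : ∀ x, Submodule ℝ (V x)) :
    Function.Surjective (quotMk (E := E) (F := F) J) := by
  intro σ
  obtain ⟨s, hs⟩ := exists_contMDiffSection_forall_mem_convex_of_local (n := ⊤) 𝓘(ℝ, E)
    (F_fiber := F) V (fun x => {v | (J x).mkQ v = σ.1 x})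
    (fun x => by
      intro v hv w hw a b _ _ hab
      simp only [mem_ofPred_eq] at hv hw ⊢
      rw [map_add, map_smul, map_smul, hv, hw, ← add_smul, hab, one_smul])
    (fun x₀ => by
      obtain ⟨U, hU, hxU, a, ha, haσ⟩ := σ.2 x₀
      exact ⟨U, hU.mem_nhds hxU, a, ha, fun y hy => (haσ y hy).symm⟩)
  exact ⟨s, Subtype.ext (funext hs)⟩

end Cutoff

/-! ### Involutive distributions -/

section Involutive

variable [FiniteDimensional ℝ E] [IsManifold 𝓘(ℝ, E) ∞ M]

/-- The Lie bracket of two smooth vector fields. -/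
def vfBracket (X Y : VectorField E M) : VectorField E M :=
  ⟨VectorField.mlieBracket 𝓘(ℝ, E) (fun x => X x) (fun x => Y x), fun x => by
    have : IsManifold 𝓘(ℝ, E) (minSmoothness ℝ 2) M := by
      rw [minSmoothness_of_isRCLikeNormedField]; exact IsManifold.of_le (n := ∞) (by norm_cast)
    have : IsManifold 𝓘(ℝ, E) (((⊤ : ℕ∞) : WithTop ℕ∞) + 1) M := ‹IsManifold 𝓘(ℝ, E) ∞ M›
    exact ContMDiffAt.mlieBracket_vectorField (m := ⊤) (n := ⊤) (X.contMDiff x) (Y.contMDiff x)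
      (by simp)⟩

/-- The distribution `D ⊆ TM` is involutive: `Γ(D)` is closed under the Lie bracket. -/
def IsInvolutive (D : ∀ x : M, Submodule ℝ (TangentSpace 𝓘(ℝ, E) x)) : Prop :=
  ∀ X ∈ secIn E E D, ∀ Y ∈ secIn E E D, vfBracket X Y ∈ secIn E E D

end Involutive

/-! ### Lie algebroids, subalgebroids and the Bott connection -/

variable (E F V) in
/-- A Lie algebroid structure on the vector bundle `V → M`: a smooth vector bundle morphism
`ρ : V → TM` over the identity (the anchor) and a real Lie algebra structure on `Γ(V)` such that
`[a, f b] = f [a, b] + (ρ(a) f) b`. (That `ρ` intertwines the brackets is a consequence.) -/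
structure LieAlgebroid [IsManifold 𝓘(ℝ, E) ∞ M] where
  /-- the anchor -/
  anchor : ∀ x : M, V x →ₗ[ℝ] TangentSpace 𝓘(ℝ, E) x
  /-- the anchor is smooth as a map of total spaces -/
  anchor_smooth : ContMDiff (𝓘(ℝ, E).prod 𝓘(ℝ, F)) (𝓘(ℝ, E).prod 𝓘(ℝ, E)) ∞
    (fun v : Bundle.TotalSpace F V => Bundle.TotalSpace.mk' E
      (E := fun x : M => TangentSpace 𝓘(ℝ, E) x) v.1 (anchor v.1 v.2))
  /-- the Lie bracket -/
  bracket : Sec E F V →ₗ[ℝ] Sec E F V →ₗ[ℝ] Sec E F V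
  bracket_self : ∀ a, bracket a a = 0
  jacobi : ∀ a b c, bracket a (bracket b c) = bracket (bracket a b) c + bracket b (bracket a c)
  leibniz : ∀ (a b : Sec E F V) (f : C^∞⟮𝓘(ℝ, E), M; ℝ⟯) (x : M),
    bracket a (fsmul f b) x = f x • bracket a b x + mvfderiv 𝓘(ℝ, E) f x (anchor x (a x)) • b x

namespace LieAlgebroid

variable [IsManifold 𝓘(ℝ, E) ∞ M] (L : LieAlgebroid E F V)

/-- The vector field `ρ(a)`. -/
def anchorSec (a : Sec E F V) : VectorField E M :=
  ⟨fun x => L.anchor x (a x), L.anchor_smooth.comp a.contMDiff⟩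

/-- `ρ : Γ(J) → Γ(D)`, when `ρ(J) ⊆ D`. -/
def anchorIn {J : ∀ x, Submodule ℝ (V x)} {D : ∀ x : M, Submodule ℝ (TangentSpace 𝓘(ℝ, E) x)}
    (h : ∀ x, ∀ v ∈ J x, L.anchor x v ∈ D x) (j : secIn E F J) : secIn E E D :=
  ⟨L.anchorSec j.1, fun x => h x _ (j.2 x)⟩

/-- `J` is a (Lie) subalgebroid: a subbundle such that `Γ(J)` is closed under the bracket. -/
structure IsSubalgebroid (J : ∀ x, Submodule ℝ (V x)) : Prop where
  subbundle : IsSubbundle E F J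
  bracket_mem : ∀ j ∈ secIn E F J, ∀ j' ∈ secIn E F J, L.bracket j j' ∈ secIn E F J

theorem bracket_swap (a b : Sec E F V) : L.bracket a b = - L.bracket b a := by
  have h := L.bracket_self (a + b)
  simp only [map_add, LinearMap.add_apply, L.bracket_self, zero_add, add_zero] at h
  exact eq_neg_of_add_eq_zero_right h

variable [FiniteDimensional ℝ E] [T2Space M]

theorem bracket_congr_right (a : Sec E F V) {b b' : Sec E F V} {x : M}
    (h : ∀ᶠ y in 𝓝 x, b y = b' y) : L.bracket a b x = L.bracket a b' x := by
  obtain ⟨f, hf1, hfU⟩ := exists_cutoff (E := E) h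
  have h0 : fsmul f (b - b') = 0 := by
    ext y
    by_cases hy : y ∈ {y | b y = b' y}
    · have : b y = b' y := hy
      simp [this]
    · have : f y = 0 := image_eq_zero_of_notMem_tsupport fun h => hy (hfU h)
      simp [this]
  have h1 := L.leibniz a (b - b') f x
  have hfx : f x = 1 := hf1.self_of_nhds
  have hbx : b x = b' x := h.self_of_nhds
  rw [h0, hfx] at h1
  simp [hbx] at h1
  exact (sub_eq_zero.1 h1.symm)

theorem bracket_congr {a a' b b' : Sec E F V} {x : M} (ha : ∀ᶠ y in 𝓝 x, a y = a' y)
    (hb : ∀ᶠ y in 𝓝 x, b y = b' y) : L.bracket a b x = L.bracket a' b' x := by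
  rw [L.bracket_congr_right a hb, L.bracket_swap a, L.bracket_swap a']
  simp [L.bracket_congr_right b' ha]

open Classical in
/-- The bracket of local sections: its value at `x` is the value at `x` of the bracket of any two
global sections with the same germs at `x`; see `localBracket_eq`. -/
def localBracket (a b : ∀ x, V x) (x : M) : V x :=
  if h : ∃ p : Sec E F V × Sec E F V,
      (∀ᶠ y in 𝓝 x, p.1 y = a y) ∧ ∀ᶠ y in 𝓝 x, p.2 y = b y then
    L.bracket h.choose.1 h.choose.2 x
  else 0

theorem localBracket_eq {a b : ∀ x, V x} {x : M} (a' b' : Sec E F V)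
    (ha : ∀ᶠ y in 𝓝 x, a' y = a y) (hb : ∀ᶠ y in 𝓝 x, b' y = b y) :
    L.localBracket a b x = L.bracket a' b' x := by
  have h : ∃ p : Sec E F V × Sec E F V,
      (∀ᶠ y in 𝓝 x, p.1 y = a y) ∧ ∀ᶠ y in 𝓝 x, p.2 y = b y := ⟨(a', b'), ha, hb⟩
  rw [localBracket, dif_pos h]
  exact L.bracket_congr
    (by filter_upwards [h.choose_spec.1, ha] with y h1 h2 using h1.trans h2.symm)
    (by filter_upwards [h.choose_spec.2, hb] with y h1 h2 using h1.trans h2.symm)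

variable [SigmaCompactSpace M]

/-- The Bott connection `∇^J : Γ(J) × Γ(V/J) → Γ(V/J)`, `∇^J_j ā` being the class of `[j, a]`;
this does not depend on the section `a` representing `ā`, see `bott_quotMk`. -/
def bott {J : ∀ x, Submodule ℝ (V x)} (_hJ : L.IsSubalgebroid J)
    (j : secIn E F J) (σ : quotSec E F J) : quotSec E F J :=
  quotMk J (L.bracket j.1 (quotMk_surjective J σ).choose)

theorem bott_quotMk {J : ∀ x, Submodule ℝ (V x)} (hJ : L.IsSubalgebroid J)
    (j : secIn E F J) (a : Sec E F V) :
    L.bott hJ j (quotMk J a) = quotMk J (L.bracket j.1 a) := by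
  set b := (quotMk_surjective J (quotMk J a)).choose with hb
  have hba : quotMk J b = quotMk J a := (quotMk_surjective J (quotMk J a)).choose_spec
  have hmem : b - a ∈ secIn E F J := fun x => by
    have := congrFun (congrArg Subtype.val hba) x
    simpa [Submodule.Quotient.eq] using this
  have h := hJ.bracket_mem j.1 j.2 _ hmem
  rw [map_sub] at h
  ext x
  have hx := h x
  simpa [bott, ← hb, Submodule.Quotient.eq] using hx

end LieAlgebroid

/-! ### Flat partial connections -/

/-- A linear `D`-connection `∇ : Γ(D) × Γ(V/J) → Γ(V/J)` on `V/J`, for a subbundle `D ⊆ TM`. -/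
structure PartialConnection [IsManifold 𝓘(ℝ, E) ∞ M]
    (D : ∀ x : M, Submodule ℝ (TangentSpace 𝓘(ℝ, E) x)) (J : ∀ x, Submodule ℝ (V x)) where
  /-- `conn X σ` is `∇_X σ` -/
  conn : secIn E E D →ₗ[ℝ] quotSec E F J →ₗ[ℝ] quotSec E F J
  conn_fsmul : ∀ (f : C^∞⟮𝓘(ℝ, E), M; ℝ⟯) X σ, conn (fsmulIn f X) σ = fsmulQuot f (conn X σ)
  leibniz : ∀ (f : C^∞⟮𝓘(ℝ, E), M; ℝ⟯) X σ (x : M),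
    (conn X (fsmulQuot f σ)).1 x =
      f x • (conn X σ).1 x + mvfderiv 𝓘(ℝ, E) f x (X.1 x) • σ.1 x

namespace PartialConnection

variable [IsManifold 𝓘(ℝ, E) ∞ M] [FiniteDimensional ℝ E]
  {D : ∀ x : M, Submodule ℝ (TangentSpace 𝓘(ℝ, E) x)} {J : ∀ x, Submodule ℝ (V x)}
  (C : PartialConnection (F := F) D J)

/-- Flatness: `∇_X ∇_Y σ - ∇_Y ∇_X σ = ∇_{[X, Y]} σ`. -/
def IsFlat (hD : IsInvolutive D) : Prop :=
  ∀ (X Y : secIn E E D) (σ : quotSec E F J),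
    C.conn X (C.conn Y σ) - C.conn Y (C.conn X σ) =
      C.conn ⟨vfBracket X.1 Y.1, hD X.1 X.2 Y.1 Y.2⟩ σ

theorem conn_congr [T2Space M] {X X' : secIn E E D} {σ σ' : quotSec E F J} {x : M}
    (hX : ∀ᶠ y in 𝓝 x, X.1 y = X'.1 y) (hσ : ∀ᶠ y in 𝓝 x, σ.1 y = σ'.1 y) :
    (C.conn X σ).1 x = (C.conn X' σ').1 x := by
  obtain ⟨f, hf1, hfU⟩ := exists_cutoff (E := E) (hX.and hσ)
  have hfx : f x = 1 := hf1.self_of_nhds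
  have hσx : σ.1 x = σ'.1 x := hσ.self_of_nhds
  have key : ∀ y, f y = 0 ∨ (X.1 y = X'.1 y ∧ σ.1 y = σ'.1 y) := fun y => by
    by_cases hy : y ∈ {y | X.1 y = X'.1 y ∧ σ.1 y = σ'.1 y}
    · exact Or.inr hy
    · exact Or.inl (image_eq_zero_of_notMem_tsupport fun h => hy (hfU h))
  have h0 : fsmulIn f (X - X') = 0 := by
    refine Subtype.ext (ContMDiffSection.ext fun y => ?_)
    change f y • (X.1 y - X'.1 y) = 0
    rcases key y with h | h
    · simp [h]
    · simp [h.1]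
  have h0' : fsmulQuot f (σ - σ') = 0 := by
    refine Subtype.ext (funext fun y => ?_)
    change f y • (σ.1 y - σ'.1 y) = 0
    rcases key y with h | h
    · simp [h]
    · simp [h.2]
  have h1 := congrFun (congrArg Subtype.val (C.conn_fsmul f (X - X') σ)) x
  have h2 := C.leibniz f X' (σ - σ') x
  rw [h0] at h1
  rw [h0'] at h2
  simp [fsmulQuot, hfx] at h1
  simp [hfx, hσx] at h2
  exact (sub_eq_zero.1 h1.symm).trans (sub_eq_zero.1 h2.symm)

open Classical in
/-- `∇_X σ` for local sections `X` of `D` and `σ` of `V/J`: the value at `x` is that for any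
global sections with the same germs at `x`; see `localConn_eq`. -/
def localConn (X : ∀ x : M, TangentSpace 𝓘(ℝ, E) x) (σ : ∀ x, V x ⧸ J x) (x : M) : V x ⧸ J x :=
  if h : ∃ p : secIn E E D × quotSec E F J,
      (∀ᶠ y in 𝓝 x, p.1.1 y = X y) ∧ ∀ᶠ y in 𝓝 x, p.2.1 y = σ y then
    (C.conn h.choose.1 h.choose.2).1 x
  else 0

theorem localConn_eq [T2Space M] {X : ∀ x : M, TangentSpace 𝓘(ℝ, E) x} {σ : ∀ x, V x ⧸ J x}
    {x : M} (X' : secIn E E D) (σ' : quotSec E F J)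
    (hX : ∀ᶠ y in 𝓝 x, X'.1 y = X y) (hσ : ∀ᶠ y in 𝓝 x, σ'.1 y = σ y) :
    C.localConn X σ x = (C.conn X' σ').1 x := by
  have h : ∃ p : secIn E E D × quotSec E F J,
      (∀ᶠ y in 𝓝 x, p.1.1 y = X y) ∧ ∀ᶠ y in 𝓝 x, p.2.1 y = σ y := ⟨(X', σ'), hX, hσ⟩
  rw [localConn, dif_pos h]
  exact C.conn_congr
    (by filter_upwards [h.choose_spec.1, hX] with y h1 h2 using h1.trans h2.symm)
    (by filter_upwards [h.choose_spec.2, hσ] with y h1 h2 using h1.trans h2.symm)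

/-- The section `a` of `V` over the open set `U` is `∇`-parallel: `∇_X ā = 0` on `U` for all
sections `X` of `D` over `U`. -/
def IsParallelOn (U : Set M) (a : ∀ x, V x) : Prop :=
  ∀ X : ∀ x : M, TangentSpace 𝓘(ℝ, E) x, IsSmoothOn E E U X → (∀ x ∈ U, X x ∈ D x) →
    ∀ x ∈ U, C.localConn X (fun y => (J y).mkQ (a y)) x = 0

end PartialConnection

end

end LieAlgd

/-!
For a section `j` of `J`, the difference `a ↦ ∇^J_j ā - ∇_{ρ(j)} ā` (`defect`) is tensorial in `ā`:
the derivative terms of the two Leibniz rules are both `ρ(j) f` and cancel (`defect_fsmul`), and the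
difference vanishes on sections of `J`. Its value at a point `x` therefore depends only on the
class of `a x` (`defect_eq_zero_of_mem_at`). On a `∇`-parallel section `a` the difference is the
class of `[j, a]`, so it vanishes there if and only if `[a, j]` lies in `J`. The equivalence thus
reduces to the existence of local parallel sections through every vector of `A/J`
(`exists_parallel_section`), and this is where flatness of `∇` and involutivity of `D` enter.

To obtain them, take a frame of `D` near `x₀` that is dual to constant functionals `ξ` on the
coordinate space. Its members commute, because their brackets lie in `D` and are annihilated
by `ξ` (`vfBracket_normalized_frame`). In a chart and in a trivialization of `A/J`, which is
identified with a complement of `J`, the equation `∇ ā = 0` becomes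
`DS(z) (B z k) + Γ z k (S z) = 0`, where the fields `z ↦ B z k` commute and `Γ` is flat.

This system is solved by radial transport (`exists_parallel_of_flat`). The curve `γ` with
`γ' = B(γ) κ`, `κ = ξ (z - z₀)`, that ends at `z` is lifted by `f' = -Γ(γ) κ f`, and `S z` is the
value of `f` at the end. Smoothness in `z` follows from the implicit function theorem on the
Banach space of continuous maps `[0, 1] → E × W` (`exists_fixedPoint_family`); at `z = z₀` the
right-hand side of the integral equation vanishes, so the linearization there is the identity. By
construction `S` is parallel in the radial direction. Flatness yields a homogeneous linear
differential equation along the radial curves for `t • ∇ₖ S`, which is zero at `t = 0`, so `S` is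
parallel in all directions of `D`.
-/

namespace LieAlgd

/-! ### Smooth dependence of fixed points of integral equations -/

section Superposition

variable {K : Type*} [TopologicalSpace K]

/-- The superposition operator `u ↦ g ∘ u` on continuous maps. -/
def superpos {V W : Type*} [TopologicalSpace V] [TopologicalSpace W] (g : C(V, W)) :
    C(K, V) → C(K, W) := fun u => g.comp u

variable [CompactSpace K]

/-- A shortcut for instance search. -/
noncomputable instance instNormedAddCommGroupContinuousMapCLM {V W : Type*}
    [NormedAddCommGroup V] [NormedSpace ℝ V] [NormedAddCommGroup W] [NormedSpace ℝ W] :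
    NormedAddCommGroup C(K, V →L[ℝ] W) := ContinuousMap.instNormedAddCommGroup

/-- A shortcut for instance search. -/
noncomputable instance instNormedSpaceContinuousMapCLM {V W : Type*}
    [NormedAddCommGroup V] [NormedSpace ℝ V] [NormedAddCommGroup W] [NormedSpace ℝ W] :
    NormedSpace ℝ C(K, V →L[ℝ] W) := ContinuousMap.normedSpace

/-- Pointwise evaluation `(A, h) ↦ (t ↦ A t (h t))` as a bounded bilinear map. -/
noncomputable def evalBilin (V W : Type*) [NormedAddCommGroup V] [NormedSpace ℝ V]
    [NormedAddCommGroup W] [NormedSpace ℝ W] : C(K, V →L[ℝ] W) →L[ℝ] C(K, V) →L[ℝ] C(K, W) :=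
  LinearMap.mkContinuous₂
    (LinearMap.mk₂ ℝ (fun A h => ⟨fun t => A t (h t), by fun_prop⟩)
      (fun _ _ _ => by ext; simp) (fun _ _ _ => by ext; simp)
      (fun _ _ _ => by ext; simp) (fun _ _ _ => by ext; simp)) 1
    (fun A h => by
      rw [ContinuousMap.norm_le _ (by positivity)]
      intro t
      rw [one_mul]
      exact ((A t).le_opNorm (h t)).trans
        (mul_le_mul (A.norm_coe_le_norm t) (h.norm_coe_le_norm t) (norm_nonneg _)
          (norm_nonneg _)))

theorem hasFDerivAt_superpos {V W : Type*} [NormedAddCommGroup V] [NormedSpace ℝ V]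
    [NormedAddCommGroup W] [NormedSpace ℝ W] (g : C(V, W)) (g' : C(V, V →L[ℝ] W))
    (hg : ∀ v, HasFDerivAt g (g' v) v) (u : C(K, V)) :
    HasFDerivAt (superpos g) (evalBilin V W (superpos g' u)) u := by
  rw [hasFDerivAt_iff_isLittleO_nhds_zero, Asymptotics.isLittleO_iff]
  intro ε hε
  have hc : Continuous (superpos g' : C(K, V) → _) := ContinuousMap.continuous_postcomp g'
  obtain ⟨δ, hδ, h⟩ := Metric.continuous_iff.1 hc u ε hε
  filter_upwards [Metric.ball_mem_nhds (0 : C(K, V)) hδ] with w hw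
  rw [ContinuousMap.norm_le _ (by positivity)]
  intro t
  have hwt : ‖w t‖ < δ := (w.norm_coe_le_norm t).trans_lt (by simpa using hw)
  -- uniform closeness of the derivatives, tested on constant perturbations of `u`
  have key : ∀ v ∈ Metric.ball (u t) δ, ‖g' v - g' (u t)‖ ≤ ε := by
    intro v hv
    have hd : dist (u + ContinuousMap.const K (v - u t)) u < δ := by
      rw [dist_eq_norm, add_sub_cancel_left]
      refine lt_of_le_of_lt ((ContinuousMap.norm_le _ (norm_nonneg (v - u t))).2 fun s => ?_)
        (by simpa [dist_eq_norm] using hv)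
      simp
    have h1 := (ContinuousMap.dist_apply_le_dist t).trans (h _ hd).le
    simpa [superpos, dist_eq_norm] using h1
  have := (convex_ball (u t) δ).norm_image_sub_le_of_norm_hasFDerivWithin_le'
    (fun v _ => (hg v).hasFDerivWithinAt) key (x := u t) (y := u t + w t)
    (Metric.mem_ball_self hδ) (by simpa using hwt)
  simp only [add_sub_cancel_left] at this
  exact this.trans (mul_le_mul_of_nonneg_left (w.norm_coe_le_norm t) hε.le)

universe u

theorem contDiff_superpos_nat (n : ℕ) {V W : Type u} [NormedAddCommGroup V] [NormedSpace ℝ V]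
    [NormedAddCommGroup W] [NormedSpace ℝ W] (g : C(V, W)) (hg : ContDiff ℝ n g) :
    ContDiff ℝ n (superpos g : C(K, V) → C(K, W)) := by
  induction n generalizing W with
  | zero => exact contDiff_zero.2 (ContinuousMap.continuous_postcomp g)
  | succ n ih =>
    have hg1 : ContDiff ℝ ((n : WithTop ℕ∞) + 1) g := by exact_mod_cast hg
    obtain ⟨hd, -, hg2⟩ := contDiff_succ_iff_fderiv.1 hg1
    let g' : C(V, V →L[ℝ] W) := ⟨fderiv ℝ g, hg2.continuous⟩
    have H := ih g' hg2
    have : ContDiff ℝ ((n : WithTop ℕ∞) + 1) (superpos g : C(K, V) → C(K, W)) := by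
      rw [contDiff_succ_iff_hasFDerivAt]
      refine ⟨fun u => evalBilin V W (superpos g' u), ?_, fun u => ?_⟩
      · exact (ContinuousLinearMap.contDiff (evalBilin (K := K) V W)).comp H
      · exact hasFDerivAt_superpos g g' (fun v => (hd v).hasFDerivAt) u
    exact_mod_cast this

/-- The superposition operator of a smooth map is smooth. -/
theorem contDiff_superpos {V W : Type*} [NormedAddCommGroup V] [NormedSpace ℝ V]
    [NormedAddCommGroup W] [NormedSpace ℝ W] (g : C(V, W)) (hg : ContDiff ℝ ∞ g) :
    ContDiff ℝ ∞ (superpos g : C(K, V) → C(K, W)) := by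
  -- lift to a common universe, where the derivatives of all orders live as well
  let eV : ULift.{max u_2 u_3} V ≃L[ℝ] V := ContinuousLinearEquiv.ulift
  let eW : ULift.{max u_2 u_3} W ≃L[ℝ] W := ContinuousLinearEquiv.ulift
  let g' : C(ULift.{max u_2 u_3} V, ULift.{max u_2 u_3} W) :=
    ⟨fun v => eW.symm (g (eV v)), by fun_prop⟩
  have hg' : ContDiff ℝ ∞ g' := eW.symm.contDiff.comp (hg.comp eV.contDiff)
  have h : ContDiff ℝ ∞ (superpos g' : C(K, _) → C(K, _)) := contDiff_infty.2 fun n =>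
    contDiff_superpos_nat n g' (hg'.of_le (by exact_mod_cast le_top))
  have := ((eW : ULift W →L[ℝ] W).compLeftContinuous ℝ K).contDiff.comp
    (h.comp ((eV.symm : V →L[ℝ] ULift V).compLeftContinuous ℝ K).contDiff (n := ∞))
  exact this

end Superposition

/-- If the partial derivative of a smooth map in the second variable is invertible at `u`, the
implicit function is smooth on a whole neighbourhood of `u.1`. -/
theorem exists_implicitFunction_eventually_contDiffAt {P Y Z : Type*}
    [NormedAddCommGroup P] [NormedSpace ℝ P] [CompleteSpace P]
    [NormedAddCommGroup Y] [NormedSpace ℝ Y] [CompleteSpace Y]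
    [NormedAddCommGroup Z] [NormedSpace ℝ Z] [CompleteSpace Z]
    {f : P × Y → Z} (hf : ContDiff ℝ ∞ f) (u : P × Y)
    (hu : (fderiv ℝ f u ∘L .inr ℝ P Y).IsInvertible) :
    ∃ φ : P → Y, φ u.1 = u.2 ∧ (∀ᶠ p in 𝓝 u.1, f (p, φ p) = f u) ∧
      (∀ᶠ v in 𝓝 u, f v = f u ↔ φ v.1 = v.2) ∧ ∀ᶠ p in 𝓝 u.1, ContDiffAt ℝ ∞ φ p := by
  have h0 : (∞ : WithTop ℕ∞) ≠ 0 := by simp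
  set φ := hf.contDiffAt.implicitFunction (u := u) h0 hu with hφ
  have hφu : φ u.1 = u.2 := hf.contDiffAt.implicitFunction_apply_self h0 hu
  have hφf := hf.contDiffAt.eventually_apply_implicitFunction h0 hu
  have hφi := hf.contDiffAt.eventually_apply_eq_iff_implicitFunction h0 hu
  have hφc : ContDiffAt ℝ ∞ φ u.1 := hf.contDiffAt.contDiffAt_implicitFunction h0 hu
  refine ⟨φ, hφu, hφf, hφi, ?_⟩
  have hcont1 : ∀ᶠ p in 𝓝 u.1, ContinuousAt φ p := by
    filter_upwards [(hφc.of_le (m := 1) (by exact_mod_cast le_top)).eventually (by simp)]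
      with p hp using hp.continuousAt
  have hgr : Tendsto (fun p => (p, φ p)) (𝓝 u.1) (𝓝 u) := by
    have : ContinuousAt (fun p => (p, φ p)) u.1 := continuousAt_id.prodMk hφc.continuousAt
    simpa [ContinuousAt, hφu] using this
  have hinv : ∀ᶠ v in 𝓝 u, (fderiv ℝ f v ∘L .inr ℝ P Y).IsInvertible := by
    obtain ⟨e, he⟩ := hu
    have hc : Continuous fun v => fderiv ℝ f v ∘L .inr ℝ P Y :=
      (hf.continuous_fderiv (by simp)).clm_comp continuous_const
    have := e.nhds
    rw [he] at this
    filter_upwards [hc.continuousAt this] with v hv using hv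
  filter_upwards [hgr.eventually hφi.eventually_nhds, hgr.eventually hinv, hφf] with p h1 h2 h3
  set ψ := hf.contDiffAt.implicitFunction (u := (p, φ p)) h0 h2
  have hψp : ψ p = φ p := hf.contDiffAt.implicitFunction_apply_self h0 h2
  have hψf := hf.contDiffAt.eventually_apply_implicitFunction h0 h2
  have hψc : ContDiffAt ℝ ∞ ψ p := hf.contDiffAt.contDiffAt_implicitFunction h0 h2
  have hgr' : Tendsto (fun q => (q, ψ q)) (𝓝 p) (𝓝 (p, φ p)) := by
    have : ContinuousAt (fun q => (q, ψ q)) p := continuousAt_id.prodMk hψc.continuousAt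
    simpa [ContinuousAt, hψp] using this
  refine hψc.congr_of_eventuallyEq ?_
  filter_upwards [hgr'.eventually h1, hψf] with q h4 h5
  exact h4.1 (h5.trans h3)

/-- `(p, u) ↦ (t ↦ (p, u t))` as a continuous linear map. -/
noncomputable def constProdCLM (K P V : Type*) [TopologicalSpace K] [CompactSpace K]
    [NormedAddCommGroup P] [NormedSpace ℝ P] [NormedAddCommGroup V] [NormedSpace ℝ V] :
    P × C(K, V) →L[ℝ] C(K, P × V) :=
  LinearMap.mkContinuous
    { toFun := fun v => (ContinuousMap.const K v.1).prodMk v.2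
      map_add' := fun _ _ => rfl
      map_smul' := fun _ _ => rfl } 1 fun v => by
    refine (ContinuousMap.norm_le _ (by positivity)).2 fun t => ?_
    rw [one_mul]
    exact max_le_max le_rfl (v.2.norm_coe_le_norm t)

/-- Solutions `u` of the equation `u = a p + T (G (p, u ·))` depend smoothly on the parameter `p`
near a parameter `p₀` at which `G` vanishes. -/
theorem exists_fixedPoint_family {K P V : Type*} [TopologicalSpace K] [CompactSpace K]
    [NormedAddCommGroup P] [NormedSpace ℝ P] [CompleteSpace P]
    [NormedAddCommGroup V] [NormedSpace ℝ V] [CompleteSpace V]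
    (G : C(P × V, V)) (hG : ContDiff ℝ ∞ G) (a : P → V) (ha : ContDiff ℝ ∞ a)
    (T : C(K, V) →L[ℝ] C(K, V)) (p₀ : P) (hG0 : ∀ v, G (p₀, v) = 0) :
    ∃ φ : P → C(K, V), φ p₀ = .const K (a p₀) ∧
      (∀ᶠ v in 𝓝 (p₀, .const K (a p₀)),
        v.2 = .const K (a v.1) + T (G.comp ((ContinuousMap.const K v.1).prodMk v.2)) ↔
          φ v.1 = v.2) ∧
      (∀ᶠ p in 𝓝 p₀, φ p = .const K (a p) +
        T (G.comp ((ContinuousMap.const K p).prodMk (φ p)))) ∧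
      ∀ᶠ p in 𝓝 p₀, ContDiffAt ℝ ∞ φ p := by
  let N : P × C(K, V) → C(K, V) := fun v => G.comp ((ContinuousMap.const K v.1).prodMk v.2)
  have hN : ContDiff ℝ ∞ N := by
    exact (contDiff_superpos (K := K) G hG).comp (constProdCLM K P V).contDiff
  let f : P × C(K, V) → C(K, V) := fun v => v.2 - ContinuousLinearMap.const ℝ K (a v.1) - T (N v)
  have hf : ContDiff ℝ ∞ f :=
    (contDiff_snd.sub ((ContinuousLinearMap.const ℝ K : V →L[ℝ] C(K, V)).contDiff.comp
      (ha.comp contDiff_fst))).sub (T.contDiff.comp hN)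
  set u : P × C(K, V) := (p₀, .const K (a p₀)) with hu
  have hN0 : ∀ w, N (p₀, w) = 0 := fun w => by ext t; simp [N, hG0]
  -- as `G` vanishes at `p₀`, the partial derivative of `f` in `u` is the identity
  have hd : fderiv ℝ f u ∘L .inr ℝ P C(K, V) = .id ℝ C(K, V) := by
    have h1 : HasFDerivAt (fun w : C(K, V) => f (p₀, w))
        (fderiv ℝ f u ∘L .inr ℝ P C(K, V)) (u.2) :=
      ((hf.differentiable (by simp)) u).hasFDerivAt.comp u.2
        (hasFDerivAt_prodMk_right p₀ u.2)
    have h2 : (fun w : C(K, V) => f (p₀, w)) =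
        fun w => w - ContinuousLinearMap.const ℝ K (a p₀) := by
      funext w
      simp [f, hN0]
    rw [h2] at h1
    exact h1.unique ((hasFDerivAt_id _).sub_const _)
  obtain ⟨φ, h1, h2, h3, h4⟩ := exists_implicitFunction_eventually_contDiffAt hf u
    (hd ▸ ⟨ContinuousLinearEquiv.refl ℝ _, rfl⟩)
  have hfu : f u = 0 := by
    simp only [f, hu, hN0, map_zero, sub_zero]
    exact sub_self _
  have hiff : ∀ v, f v = f u ↔
      v.2 = .const K (a v.1) + T (G.comp ((ContinuousMap.const K v.1).prodMk v.2)) := by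
    intro v
    rw [hfu]
    change v.2 - _ - _ = 0 ↔ _
    rw [sub_sub, sub_eq_zero]
    rfl
  refine ⟨φ, h1, ?_, ?_, h4⟩
  · filter_upwards [h3] with v hv using (hiff v).symm.trans hv
  · filter_upwards [h2] with p hp using (hiff _).1 hp

/-! ### Radial parallel transport -/

section Radial

/-- The primitive `t ↦ ∫₀ᵗ h` of a continuous function on the unit interval, as a continuous
linear operator. -/
noncomputable def primitiveCLM (V : Type*) [NormedAddCommGroup V] [NormedSpace ℝ V]
    [CompleteSpace V] : C(unitInterval, V) →L[ℝ] C(unitInterval, V) :=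
  LinearMap.mkContinuous
    { toFun := fun h => ⟨fun t => ∫ τ in (0 : ℝ)..t, h (projIcc 0 1 zero_le_one τ),
        (intervalIntegral.continuous_primitive (fun _ _ =>
          (h.continuous.comp continuous_projIcc).intervalIntegrable _ _) 0).comp
            continuous_subtype_val⟩
      map_add' := fun h k => by
        ext t
        exact intervalIntegral.integral_add
          ((h.continuous.comp continuous_projIcc).intervalIntegrable _ _)
          ((k.continuous.comp continuous_projIcc).intervalIntegrable _ _)
      map_smul' := fun r h => by
        ext t
        exact intervalIntegral.integral_smul r _ } 1 fun h => by
    refine (ContinuousMap.norm_le _ (by positivity)).2 fun t => ?_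
    have := intervalIntegral.norm_integral_le_of_norm_le_const (a := 0) (b := (t : ℝ))
      (C := ‖h‖) (f := fun τ => h (projIcc 0 1 zero_le_one τ)) fun τ _ => h.norm_coe_le_norm _
    refine this.trans ?_
    rw [one_mul, sub_zero, abs_of_nonneg t.2.1]
    exact mul_le_of_le_one_right (norm_nonneg _) t.2.2

theorem primitiveCLM_apply {V : Type*} [NormedAddCommGroup V] [NormedSpace ℝ V]
    [CompleteSpace V] (h : C(unitInterval, V)) (t : unitInterval) :
    primitiveCLM V h t = ∫ τ in (0 : ℝ)..t, h (projIcc 0 1 zero_le_one τ) := rfl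

variable {E K W : Type*} [NormedAddCommGroup E] [NormedSpace ℝ E] [CompleteSpace E]
  [NormedAddCommGroup K] [NormedSpace ℝ K] [CompleteSpace K]
  [NormedAddCommGroup W] [NormedSpace ℝ W] [CompleteSpace W]

/-- The operator `h ↦ (t ↦ (-∫ₜ¹ h₁, ∫₀ᵗ h₂))`, which encodes a terminal condition on the first
component and an initial condition on the second one. -/
noncomputable def mixedPrimitive (E W : Type*) [NormedAddCommGroup E] [NormedSpace ℝ E]
    [CompleteSpace E] [NormedAddCommGroup W] [NormedSpace ℝ W] [CompleteSpace W] :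
    C(unitInterval, E × W) →L[ℝ] C(unitInterval, E × W) :=
  primitiveCLM (E × W) - (ContinuousLinearMap.const ℝ unitInterval).comp
    ((ContinuousLinearMap.inl ℝ E W ∘L ContinuousLinearMap.fst ℝ E W).comp
      ((ContinuousMap.evalCLM ℝ (1 : unitInterval)).comp (primitiveCLM (E × W))))

theorem mixedPrimitive_apply (h : C(unitInterval, E × W)) (t : unitInterval) :
    mixedPrimitive E W h t = primitiveCLM (E × W) h t - ((primitiveCLM (E × W) h 1).1, 0) := rfl

theorem eq_const_add_mixedPrimitive_iff (u g : C(unitInterval, E × W)) (a : E × W) :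
    u = .const _ a + mixedPrimitive E W g ↔
      (∀ t, u t = u 0 + primitiveCLM (E × W) g t) ∧ (u 1).1 = a.1 ∧ (u 0).2 = a.2 := by
  have h0 : primitiveCLM (E × W) g 0 = 0 := by
    rw [primitiveCLM_apply]; exact intervalIntegral.integral_same
  constructor
  · intro h
    have key : ∀ t, u t = a + (primitiveCLM (E × W) g t - ((primitiveCLM (E × W) g 1).1, 0)) := by
      intro t
      conv_lhs => rw [h]
      rfl
    refine ⟨fun t => ?_, ?_, ?_⟩
    · rw [key t, key 0, h0]; abel
    · rw [key 1]; simp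
    · rw [key 0, h0]; simp
  · rintro ⟨h, h1, h2⟩
    have h3 := congrArg Prod.fst (h 1)
    rw [h1] at h3
    ext t
    · rw [h t]
      simp [mixedPrimitive_apply, h3]
    · rw [h t]
      simp [mixedPrimitive_apply, h2]

/-- Along the curves `γ` with `γ' = B(γ) κ`, where `κ = ξ (z - z₀)` and `γ 1 = z`, transport the
vector `c` from time `0` to time `1` by `f' = -Γ(γ) κ f`; the result `S z` depends smoothly on `z`,
and its restriction to each of these curves is the transported vector. -/
theorem exists_radial_transport (B : E → K →L[ℝ] E) (hB : ContDiff ℝ ∞ B)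
    (Γ : E → K →L[ℝ] W →L[ℝ] W) (hΓ : ContDiff ℝ ∞ Γ) (ξ : E →L[ℝ] K) (z₀ : E)
    (hξ : ∀ᶠ z in 𝓝 z₀, ∀ k, ξ (B z k) = k) (c : W) :
    ∃ S : E → W, S z₀ = c ∧ (∀ᶠ z in 𝓝 z₀, ContDiffAt ℝ ∞ S z) ∧
      ∀ N ∈ 𝓝 z₀, ∀ᶠ z in 𝓝 z₀, ∃ U : ℝ → E × W, U 1 = (z, S z) ∧ ∀ t ∈ Icc (0 : ℝ) 1,
        HasDerivAt U (B (U t).1 (ξ (z - z₀)), - Γ (U t).1 (ξ (z - z₀)) (U t).2) t ∧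
        S (U t).1 = (U t).2 ∧ ξ ((U t).1 - z₀) = t • ξ (z - z₀) ∧ (U t).1 ∈ N := by
  have hGs : ContDiff ℝ ∞ fun q : E × (E × W) =>
      ((B q.2.1 (ξ (q.1 - z₀)), - Γ q.2.1 (ξ (q.1 - z₀)) q.2.2) : E × W) := by
    fun_prop
  let G : C(E × (E × W), E × W) := ⟨_, hGs.continuous⟩
  have hGdef : ∀ z v, G (z, v) = (B v.1 (ξ (z - z₀)), - Γ v.1 (ξ (z - z₀)) v.2) :=
    fun _ _ => rfl
  obtain ⟨φ, hφ0, hφi, hφe, hφs⟩ := exists_fixedPoint_family G hGs (fun z => (z, c))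
    (contDiff_id.prodMk contDiff_const) (mixedPrimitive E W) z₀ (fun v => by simp [hGdef])
  have hφc : Tendsto φ (𝓝 z₀) (𝓝 (.const _ (z₀, c))) := by
    have := hφs.self_of_nhds.continuousAt
    rwa [ContinuousAt, hφ0] at this
  refine ⟨fun z => (φ z 1).2, by simp [hφ0], ?_, fun N hN => ?_⟩
  · filter_upwards [hφs] with z hz
    exact contDiffAt_snd.comp z
      (((ContinuousMap.evalCLM ℝ (1 : unitInterval) :
        C(unitInterval, E × W) →L[ℝ] E × W).contDiff.contDiffAt).comp z hz)
  -- a radius within which all the local properties hold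
  obtain ⟨ε, hε, hεball⟩ : ∃ ε > 0, ∀ z ∈ Metric.ball z₀ ε, z ∈ N ∧ (∀ k, ξ (B z k) = k) ∧
      ∀ v ∈ Metric.ball (ContinuousMap.const unitInterval (z₀, c)) ε,
        v = .const _ (z, c) + mixedPrimitive E W (G.comp ((ContinuousMap.const _ z).prodMk v)) →
          φ z = v := by
    obtain ⟨ε₁, h1, h2⟩ := Metric.eventually_nhds_iff_ball.1 (hξ.and hN)
    obtain ⟨ε₂, h3, h4⟩ := Metric.eventually_nhds_iff_ball.1 hφi
    refine ⟨min ε₁ ε₂, lt_min h1 h3, fun z hz => ⟨?_, ?_, fun v hv h => ?_⟩⟩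
    · exact (h2 z (Metric.ball_subset_ball (min_le_left _ _) hz)).2
    · exact (h2 z (Metric.ball_subset_ball (min_le_left _ _) hz)).1
    · refine (h4 (z, v) ?_).1 h
      rw [← ball_prod_same]
      exact ⟨Metric.ball_subset_ball (min_le_right _ _) hz,
        Metric.ball_subset_ball (min_le_right _ _) hv⟩
  filter_upwards [hφe, hφc.eventually (Metric.ball_mem_nhds _ hε)] with z hz hzε
  obtain ⟨hint, hz1, hz0⟩ := (eq_const_add_mixedPrimitive_iff _ _ _).1 hz
  simp only at hz1 hz0
  set κ := ξ (z - z₀) with hκ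
  have hball : ∀ t, (φ z t).1 ∈ Metric.ball z₀ ε := fun t =>
    (le_max_left _ _).trans_lt ((ContinuousMap.dist_apply_le_dist (f := φ z)
      (g := ContinuousMap.const _ (z₀, c)) t).trans_lt hzε)
  -- the integrand, and the extension of the curve to the whole line
  let g : ℝ → E × W := fun τ => G (z, φ z (projIcc 0 1 zero_le_one τ))
  have hg : Continuous g := by
    have : Continuous (projIcc (0 : ℝ) 1 zero_le_one) := continuous_projIcc
    fun_prop
  let U : ℝ → E × W := fun t => φ z 0 + ∫ τ in (0 : ℝ)..t, g τ
  have hU : ∀ t : unitInterval, U t = φ z t := fun t => by rw [hint t]; rfl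
  have hUd : ∀ t, HasDerivAt U (g t) t := fun t =>
    (intervalIntegral.integral_hasDerivAt_right (hg.intervalIntegrable _ _)
      (hg.stronglyMeasurableAtFilter _ _) hg.continuousAt).const_add _
  have hξU : ∀ t : unitInterval, ξ ((φ z t).1 - z₀) = (t : ℝ) • κ := by
    have hlin : ∀ t : unitInterval, ξ (φ z t).1 = ξ (φ z 0).1 + (t : ℝ) • κ := by
      intro t
      have h1 := ContinuousLinearMap.intervalIntegral_comp_comm (a := 0) (b := (t : ℝ))
        (ξ ∘L ContinuousLinearMap.fst ℝ E W) (hg.intervalIntegrable (μ := MeasureTheory.volume) 0 t)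
      have h2 : ∀ τ, (ξ ∘L ContinuousLinearMap.fst ℝ E W) (g τ) = κ := fun τ =>
        (hεball _ (hball _)).2.1 κ
      simp only [h2, intervalIntegral.integral_const, sub_zero] at h1
      rw [h1, ← hU t]
      simp [U]
    have h1 := hlin 1
    rw [hz1] at h1
    intro t
    have h0 : ξ (φ z 0).1 = ξ z₀ := by
      have : ξ z = ξ z₀ + κ := by rw [hκ, map_sub]; abel
      rw [this] at h1
      simpa using h1.symm
    rw [map_sub, hlin t, h0]; abel
  refine ⟨U, ?_, fun t ht => ?_⟩
  · have := hU 1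
    rw [Icc.coe_one] at this
    rw [this]
    exact Prod.ext hz1 rfl
  lift t to unitInterval using ht
  have hgt : g t = (B (U t).1 κ, - Γ (U t).1 κ (U t).2) := by
    rw [hU t]
    simp only [g, projIcc_val, hGdef]
    rfl
  refine ⟨hgt ▸ hUd t, ?_, by rw [hU t]; exact hξU t, by rw [hU t]; exact (hεball _ (hball t)).1⟩
  -- the curve ending at an earlier point is a reparametrization of the given one
  rw [hU t]
  let v : C(unitInterval, E × W) := ⟨fun s => φ z (t * s), by fun_prop⟩
  have hv : v ∈ Metric.ball (ContinuousMap.const unitInterval (z₀, c)) ε := by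
    refine lt_of_le_of_lt ((ContinuousMap.dist_le dist_nonneg).2 fun s => ?_) hzε
    exact ContinuousMap.dist_apply_le_dist (f := φ z)
      (g := ContinuousMap.const _ (z₀, c)) (t * s)
  have hveq := (hεball _ (hball t)).2.2 v hv <| by
    rw [eq_const_add_mixedPrimitive_iff]
    refine ⟨fun s => ?_, by simp [v], by simp [v, hz0]⟩
    rw [primitiveCLM_apply]
    have h1 : ∀ τ ∈ uIcc (0 : ℝ) s, (G.comp ((ContinuousMap.const unitInterval (φ z t).1).prodMk v))
        (projIcc 0 1 zero_le_one τ) = (t : ℝ) • g (t * τ) := by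
      intro τ hτ
      rw [uIcc_of_le s.2.1] at hτ
      have hτ1 : τ ∈ unitInterval := ⟨hτ.1, hτ.2.trans s.2.2⟩
      lift τ to unitInterval using hτ1
      have h2 : projIcc 0 1 zero_le_one ((t : ℝ) * τ) = t * τ :=
        projIcc_val zero_le_one (t * τ)
      simp only [g, h2, projIcc_val]
      change G ((φ z t).1, φ z (t * τ)) = _
      rw [hGdef, hGdef, hξU t, ← hκ]
      simp
    rw [intervalIntegral.integral_congr h1, intervalIntegral.integral_smul,
      intervalIntegral.smul_integral_comp_mul_left, mul_zero]
    have h3 := hU (t * s)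
    simp only [v, ContinuousMap.coe_mk, mul_zero]
    rw [← h3]
    rfl
  rw [hveq]
  simp [v]

end Radial

/-! ### Parallel sections of a flat connection in coordinates -/

section Flat

variable {E K W : Type*} [NormedAddCommGroup E] [NormedSpace ℝ E]
  [NormedAddCommGroup K] [NormedSpace ℝ K]
  [NormedAddCommGroup W] [NormedSpace ℝ W]

/-- The covariant derivative `∇ S = DS ∘ B + Γ S` along the fields `z ↦ B z k`. -/
noncomputable def covDeriv (B : E → K →L[ℝ] E) (Γ : E → K →L[ℝ] W →L[ℝ] W) (S : E → W) (z : E) :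
    K →L[ℝ] W :=
  fderiv ℝ S z ∘L B z + ContinuousLinearMap.apply ℝ W (S z) ∘L Γ z

theorem covDeriv_apply (B : E → K →L[ℝ] E) (Γ : E → K →L[ℝ] W →L[ℝ] W) (S : E → W) (z : E)
    (k : K) : covDeriv B Γ S z k = fderiv ℝ S z (B z k) + Γ z k (S z) := rfl

set_option synthInstance.maxHeartbeats 200000 in
theorem contDiffAt_covDeriv {B : E → K →L[ℝ] E} (hB : ContDiff ℝ ∞ B)
    {Γ : E → K →L[ℝ] W →L[ℝ] W} (hΓ : ContDiff ℝ ∞ Γ) {S : E → W} {z : E}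
    (hS : ContDiffAt ℝ ∞ S z) : ContDiffAt ℝ ∞ (covDeriv B Γ S) z := by
  have h1 : ContDiffAt ℝ ∞ (fderiv ℝ S) z := hS.fderiv_right (by simp)
  have h2 : ContDiffAt ℝ ∞ (fun z => ContinuousLinearMap.apply ℝ W (S z)) z :=
    (ContinuousLinearMap.apply ℝ W : W →L[ℝ] (W →L[ℝ] W) →L[ℝ] W).contDiff.contDiffAt.comp z hS
  exact (h1.clm_comp hB.contDiffAt).add (h2.clm_comp hΓ.contDiffAt)

set_option synthInstance.maxHeartbeats 200000 in
theorem fderiv_covDeriv {B : E → K →L[ℝ] E} (hB : ContDiff ℝ ∞ B)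
    {Γ : E → K →L[ℝ] W →L[ℝ] W} (hΓ : ContDiff ℝ ∞ Γ) {S : E → W} {z : E}
    (hS : ContDiffAt ℝ ∞ S z) (v : E) (l : K) :
    fderiv ℝ (covDeriv B Γ S) z v l = fderiv ℝ (fderiv ℝ S) z v (B z l) +
      fderiv ℝ S z (fderiv ℝ B z v l) + fderiv ℝ Γ z v l (S z) + Γ z l (fderiv ℝ S z v) := by
  have hw := ((contDiffAt_covDeriv hB hΓ hS).differentiableAt (by simp)).hasFDerivAt
  have h1 := hw.clm_apply (hasFDerivAt_const l z)
  have hS1 := (hS.differentiableAt (by simp)).hasFDerivAt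
  have hS2 : HasFDerivAt (fderiv ℝ S) _ z :=
    ((hS.fderiv_right (m := ∞) (by simp)).differentiableAt (by simp)).hasFDerivAt
  have hB1 := (hB.differentiable (by simp) z).hasFDerivAt
  have hΓ1 := (hΓ.differentiable (by simp) z).hasFDerivAt
  have h2 := (hS2.clm_apply (hB1.clm_apply (hasFDerivAt_const l z))).add
    ((hΓ1.clm_apply (hasFDerivAt_const l z)).clm_apply hS1)
  have h3 := congrArg (fun A => A v) (h1.unique h2)
  simp at h3
  rw [h3]
  abel

/-- Commuting covariant derivatives: the curvature identity `∇ₖ (∇ₗ S) = ∇ₗ (∇ₖ S)`. -/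
theorem fderiv_covDeriv_add_comm {B : E → K →L[ℝ] E} (hB : ContDiff ℝ ∞ B)
    {Γ : E → K →L[ℝ] W →L[ℝ] W} (hΓ : ContDiff ℝ ∞ Γ) {S : E → W} {z : E}
    (hS : ContDiffAt ℝ ∞ S z)
    (hcomm : ∀ k l, fderiv ℝ B z (B z k) l = fderiv ℝ B z (B z l) k)
    (hflat : ∀ k l (v : W), fderiv ℝ Γ z (B z k) l v + Γ z k (Γ z l v) =
      fderiv ℝ Γ z (B z l) k v + Γ z l (Γ z k v)) (k l : K) :
    fderiv ℝ (covDeriv B Γ S) z (B z k) l + Γ z k (covDeriv B Γ S z l) =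
      fderiv ℝ (covDeriv B Γ S) z (B z l) k + Γ z l (covDeriv B Γ S z k) := by
  have hsymm := (hS.isSymmSndFDerivAt (by
    rw [minSmoothness_of_isRCLikeNormedField]; norm_cast)).eq (B z k) (B z l)
  rw [fderiv_covDeriv hB hΓ hS, fderiv_covDeriv hB hΓ hS, covDeriv_apply, covDeriv_apply,
    map_add, map_add, hsymm, hcomm k l]
  have h := hflat k l (S z)
  rw [← sub_eq_zero] at h ⊢
  rw [← h]
  abel

/-- **Frobenius theorem for flat connections, in coordinates.** The fields `z ↦ B z k` commute,
and are adapted to the coordinates `ξ`; the connection with coefficients `Γ` along them is flat.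
Then there is a smooth parallel section with prescribed value at `z₀`.

The section `S` obtained by radial transport satisfies `∇_R S = 0` for the radial field
`R z = B z (ξ (z - z₀))`. As `[R, B k] = -B k`, flatness turns this into a linear homogeneous
differential equation for `t • ∇ₖ S` along the radial curves. -/
theorem exists_parallel_of_flat [CompleteSpace E] [CompleteSpace K] [CompleteSpace W]
    (B : E → K →L[ℝ] E) (hB : ContDiff ℝ ∞ B)
    (Γ : E → K →L[ℝ] W →L[ℝ] W) (hΓ : ContDiff ℝ ∞ Γ) (ξ : E →L[ℝ] K) (z₀ : E)
    (hξ : ∀ᶠ z in 𝓝 z₀, ∀ k, ξ (B z k) = k)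
    (hcomm : ∀ᶠ z in 𝓝 z₀, ∀ k l, fderiv ℝ B z (B z k) l = fderiv ℝ B z (B z l) k)
    (hflat : ∀ᶠ z in 𝓝 z₀, ∀ k l (v : W), fderiv ℝ Γ z (B z k) l v + Γ z k (Γ z l v) =
      fderiv ℝ Γ z (B z l) k v + Γ z l (Γ z k v)) (c : W) :
    ∃ S : E → W, S z₀ = c ∧ ∀ᶠ z in 𝓝 z₀, ContDiffAt ℝ ∞ S z ∧
      ∀ k, fderiv ℝ S z (B z k) + Γ z k (S z) = 0 := by
  obtain ⟨S, hS0, hS, hU⟩ := exists_radial_transport B hB Γ hΓ ξ z₀ hξ c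
  refine ⟨S, hS0, ?_⟩
  set w := covDeriv B Γ S with hwdef
  -- the section is parallel in the radial direction
  have hrad : ∀ᶠ z in 𝓝 z₀, w z (ξ (z - z₀)) = 0 := by
    filter_upwards [hS, hU univ univ_mem] with z hz hUz
    obtain ⟨U, hU1, hUt⟩ := hUz
    have h1 := (hUt 1 (right_mem_Icc.2 zero_le_one)).1
    rw [hU1] at h1
    have hfst : HasDerivAt (fun t => (U t).1) (B z (ξ (z - z₀))) 1 :=
      (ContinuousLinearMap.fst ℝ E W).hasFDerivAt.comp_hasDerivAt 1 h1
    have hsnd : HasDerivAt (fun t => (U t).2) (- Γ z (ξ (z - z₀)) (S z)) 1 :=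
      (ContinuousLinearMap.snd ℝ E W).hasFDerivAt.comp_hasDerivAt 1 h1
    have hSd : HasFDerivAt S (fderiv ℝ S z) (U 1).1 := by
      rw [hU1]; exact (hz.differentiableAt (by simp)).hasFDerivAt
    have hcomp : HasDerivAt (fun t => S (U t).1) _ 1 := hSd.comp_hasDerivAt 1 hfst
    have huniq : UniqueDiffWithinAt ℝ (Icc (0 : ℝ) 1) 1 :=
      uniqueDiffOn_Icc zero_lt_one 1 (right_mem_Icc.2 zero_le_one)
    have := huniq.eq_deriv _ (hsnd.hasDerivWithinAt (s := Icc (0 : ℝ) 1))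
      (hcomp.hasDerivWithinAt.congr (fun t ht => ((hUt t ht).2.1).symm)
        ((hUt 1 (right_mem_Icc.2 zero_le_one)).2.1).symm)
    rw [hwdef, covDeriv_apply, ← this, neg_add_cancel]
  have hw : ∀ᶠ z in 𝓝 z₀, ContDiffAt ℝ ∞ w z := hS.mono fun z hz => contDiffAt_covDeriv hB hΓ hz
  -- derivative of the radial identity
  have hrad' : ∀ᶠ z in 𝓝 z₀, ∀ k, fderiv ℝ w z (B z k) (ξ (z - z₀)) + w z k = 0 := by
    filter_upwards [hrad.eventually_nhds, hw, hξ] with z h1 h2 h3 k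
    have h4 := ((h2.differentiableAt (by simp)).hasFDerivAt).clm_apply
      (ξ.hasFDerivAt.comp z ((hasFDerivAt_id z).sub_const z₀))
    have h5 : HasFDerivAt (fun z => w z (ξ (z - z₀))) (0 : E →L[ℝ] W) z :=
      (hasFDerivAt_const (0 : W) z).congr_of_eventuallyEq h1
    have h6 := congrArg (fun A => A (B z k)) (h4.unique h5)
    simpa [h3, add_comm] using h6
  have hall := hrad.and (hrad'.and (hw.and (hS.and (hcomm.and hflat))))
  filter_upwards [hU _ hall, hS] with z hUz hz
  refine ⟨hz, fun k => ?_⟩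
  obtain ⟨U, hU1, hUt⟩ := hUz
  set κ := ξ (z - z₀) with hκ
  -- the linear equation satisfied by `t • ∇ₖ S` along the radial curve
  have hder : ∀ t ∈ Icc (0 : ℝ) 1, HasDerivAt (fun t => t • w (U t).1 k)
      (- Γ (U t).1 κ (t • w (U t).1 k)) t := by
    intro t ht
    obtain ⟨hd, -, hξt, h1, h2, h3, h4, h5, h6⟩ := hUt t ht
    have hfst : HasDerivAt (fun t => (U t).1) (B (U t).1 κ) t :=
      (ContinuousLinearMap.fst ℝ E W).hasFDerivAt.comp_hasDerivAt t hd
    have hwd := (h3.differentiableAt (by simp)).hasFDerivAt.comp_hasDerivAt t hfst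
    have hmain := (hasDerivAt_id t).smul (hwd.clm_apply (hasDerivAt_const t k))
    refine HasDerivAt.congr_deriv (f := fun t => t • w (U t).1 k) hmain ?_
    have h7 := fderiv_covDeriv_add_comm hB hΓ h4 h5 h6 k κ
    have h8 := h2 k
    rw [hξt] at h1 h8
    rw [map_smul] at h1 h8
    have h9 : t • fderiv ℝ w (U t).1 (B (U t).1 κ) k =
        - w (U t).1 k - t • Γ (U t).1 κ (w (U t).1 k) := by
      have h10 : fderiv ℝ w (U t).1 (B (U t).1 κ) k = fderiv ℝ w (U t).1 (B (U t).1 k) κ +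
          Γ (U t).1 k (w (U t).1 κ) - Γ (U t).1 κ (w (U t).1 k) := by
        rw [h7]; abel
      have h11 : t • Γ (U t).1 k (w (U t).1 κ) = 0 := by rw [← map_smul, h1, map_zero]
      rw [h10, smul_sub, smul_add, h11, add_zero, eq_neg_of_add_eq_zero_left h8]
    simp [h9]
    abel
  have hcont : ContinuousOn (fun t => (U t).1) (Icc 0 1) := fun t ht =>
    ((hUt t ht).1.continuousAt.fst).continuousWithinAt
  obtain ⟨C, hC⟩ := isCompact_Icc.exists_bound_of_continuousOn
    (f := fun t => Γ (U t).1 κ)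
    ((hΓ.continuous.comp_continuousOn hcont).clm_apply continuousOn_const)
  have hzero := eq_zero_of_abs_deriv_le_mul_abs_self_of_eq_zero_right (K := C)
    (fun t ht => (hder t ht).continuousAt.continuousWithinAt)
    (fun t ht => (hder t (Ico_subset_Icc_self ht)).hasDerivWithinAt) (by simp)
    (fun t ht => by
      rw [norm_neg]
      exact ((Γ (U t).1 κ).le_opNorm _).trans
        (mul_le_mul_of_nonneg_right (hC t (Ico_subset_Icc_self ht)) (norm_nonneg _)))
    1 (right_mem_Icc.2 zero_le_one)
  rw [hU1, one_smul] at hzero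
  exact hzero

end Flat

/-! ### Normalized frames of subbundles and trivializations of quotient bundles -/

section Frames

variable {E : Type*} [NormedAddCommGroup E] [NormedSpace ℝ E]
  {M : Type*} [TopologicalSpace M] [ChartedSpace E M]
  {F : Type*} [NormedAddCommGroup F] [NormedSpace ℝ F]
  {V : M → Type*} [TopologicalSpace (Bundle.TotalSpace F V)]
  [∀ x, TopologicalSpace (V x)] [∀ x, AddCommGroup (V x)] [∀ x, Module ℝ (V x)]
  [FiberBundle F V] [VectorBundle ℝ F V]

variable (F V) in
/-- The fibrewise linear map to the typical fibre given by the preferred trivialization at `x₀`. -/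
noncomputable def toFibre (x₀ x : M) : V x →ₗ[ℝ] F := (trivializationAt F V x₀).linearMapAt ℝ x

variable (F V) in
/-- The inverse of `toFibre`. -/
noncomputable def ofFibre (x₀ x : M) : F →ₗ[ℝ] V x := (trivializationAt F V x₀).symmₗ ℝ x

variable (F V) in
theorem baseSet_mem_nhds (x₀ : M) : (trivializationAt F V x₀).baseSet ∈ 𝓝 x₀ :=
  (trivializationAt F V x₀).open_baseSet.mem_nhds (FiberBundle.mem_baseSet_trivializationAt' x₀)

theorem ofFibre_toFibre {x₀ x : M} (hx : x ∈ (trivializationAt F V x₀).baseSet) (v : V x) :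
    ofFibre F V x₀ x (toFibre F V x₀ x v) = v :=
  (trivializationAt F V x₀).symmₗ_linearMapAt hx v

theorem toFibre_ofFibre {x₀ x : M} (hx : x ∈ (trivializationAt F V x₀).baseSet) (w : F) :
    toFibre F V x₀ x (ofFibre F V x₀ x w) = w :=
  (trivializationAt F V x₀).linearMapAt_symmₗ hx w

/-- Evaluation of sections at a point. -/
noncomputable def secEval (x : M) : Sec E F V →ₗ[ℝ] V x where
  toFun s := s x
  map_add' _ _ := rfl
  map_smul' _ _ := rfl

@[simp] theorem secEval_apply (x : M) (s : Sec E F V) : secEval x s = s x := rfl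

variable [ContMDiffVectorBundle ∞ F V 𝓘(ℝ, E)]

theorem contMDiffAt_section_iff_toFibre {x₀ x : M}
    (hx : x ∈ (trivializationAt F V x₀).baseSet) (s : ∀ x, V x) :
    ContMDiffAt 𝓘(ℝ, E) (𝓘(ℝ, E).prod 𝓘(ℝ, F)) ∞
      (fun x => Bundle.TotalSpace.mk' F x (s x)) x ↔
    ContMDiffAt 𝓘(ℝ, E) 𝓘(ℝ, F) ∞ (fun x => toFibre F V x₀ x (s x)) x := by
  rw [(trivializationAt F V x₀).contMDiffAt_section_iff hx]
  have : (fun x => toFibre F V x₀ x (s x)) =ᶠ[𝓝 x]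
      fun x => (trivializationAt F V x₀ ⟨x, s x⟩).2 := by
    filter_upwards [(trivializationAt F V x₀).open_baseSet.mem_nhds hx] with y hy
    exact congrFun ((trivializationAt F V x₀).coe_linearMapAt_of_mem (R := ℝ) hy) (s y)
  exact ⟨fun h => h.congr_of_eventuallyEq this, fun h => h.congr_of_eventuallyEq this.symm⟩

variable [FiniteDimensional ℝ E] [FiniteDimensional ℝ F] [T2Space M] [IsManifold 𝓘(ℝ, E) ∞ M]

/-- Near every point a subbundle `J` has a frame of global sections of `J` which is dual to some
linear functionals on the typical fibre. -/
theorem exists_normalized_frame {J : ∀ x, Submodule ℝ (V x)} (hJ : IsSubbundle E F J) (x₀ : M) :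
    ∃ (k : ℕ) (Λ : F →L[ℝ] (Fin k → ℝ)) (X : (Fin k → ℝ) →ₗ[ℝ] secIn E F J), ∀ᶠ x in 𝓝 x₀,
      (∀ c, Λ (toFibre F V x₀ x ((X c).1 x)) = c) ∧
      ∀ v ∈ J x, (X (Λ (toFibre F V x₀ x v))).1 x = v := by
  obtain ⟨U, hU, hxU, k, s, hs, hspan⟩ := hJ x₀
  set b := (trivializationAt F V x₀).baseSet
  have hb : b ∈ 𝓝 x₀ := baseSet_mem_nhds F V x₀
  -- the frame in the trivialization
  let P : M → (Fin k → ℝ) →L[ℝ] F := fun x =>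
    ∑ i, (ContinuousLinearMap.proj (R := ℝ) (φ := fun _ : Fin k => ℝ) i).smulRight
      (toFibre F V x₀ x (s i x))
  have hPapp : ∀ x c, P x c = toFibre F V x₀ x (∑ i, c i • s i x) := by
    intro x c
    simp [P, map_sum]
  have hPs : ∀ x ∈ U ∩ b, ContMDiffAt 𝓘(ℝ, E) 𝓘(ℝ, (Fin k → ℝ) →L[ℝ] F) ∞ P x := by
    intro x hx
    refine ContMDiffAt.sum fun i _ => ?_
    have h1 := (contMDiffAt_section_iff_toFibre hx.2 (s i)).1
      ((hs i).contMDiffAt (hU.mem_nhds hx.1))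
    exact (ContinuousLinearMap.smulRightL ℝ (Fin k → ℝ) F
      (ContinuousLinearMap.proj i)).contMDiff.contMDiffAt.comp x h1
  have hPinj : LinearMap.ker (P x₀ : (Fin k → ℝ) →ₗ[ℝ] F) = ⊥ := by
    rw [LinearMap.ker_eq_bot']
    intro c hc
    have h1 : ∑ i, c i • s i x₀ = 0 := by
      rw [← ofFibre_toFibre (mem_of_mem_nhds hb) (∑ i, c i • s i x₀), ← hPapp]
      rw [show P x₀ c = 0 from hc, map_zero]
    exact funext (Fintype.linearIndependent_iff.1 (hspan x₀ hxU).1 c h1)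
  obtain ⟨Λ, hΛ⟩ : ∃ Λ : F →L[ℝ] (Fin k → ℝ), Λ ∘L P x₀ = .id ℝ _ := by
    obtain ⟨Λ, hΛ⟩ := LinearMap.exists_leftInverse_of_injective _ hPinj
    refine ⟨LinearMap.toContinuousLinearMap Λ, ContinuousLinearMap.ext fun c => ?_⟩
    exact LinearMap.congr_fun hΛ c
  let G : M → (Fin k → ℝ) →L[ℝ] (Fin k → ℝ) := fun x => Λ ∘L P x
  have hGs : ∀ x ∈ U ∩ b, ContMDiffAt 𝓘(ℝ, E) 𝓘(ℝ, (Fin k → ℝ) →L[ℝ] (Fin k → ℝ)) ∞ G x :=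
    fun x hx => contMDiffAt_const.clm_comp (hPs x hx)
  -- where the frame can be normalized
  obtain ⟨O, hOsub, hO, hxO⟩ : ∃ O ⊆ {x | x ∈ U ∩ b ∧ (G x).IsInvertible}, IsOpen O ∧ x₀ ∈ O := by
    rw [← mem_nhds_iff]
    have hid : (ContinuousLinearEquiv.refl ℝ (Fin k → ℝ) : (Fin k → ℝ) →L[ℝ] _) = G x₀ := hΛ.symm
    have h1 := (ContinuousLinearEquiv.refl ℝ (Fin k → ℝ)).nhds
    rw [hid] at h1
    filter_upwards [hU.mem_nhds hxU, hb,
      (hGs x₀ ⟨hxU, mem_of_mem_nhds hb⟩).continuousAt h1] with x h2 h3 h4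
    exact ⟨⟨h2, h3⟩, h4⟩
  let s' : Fin k → ∀ x, V x := fun i x => ∑ j, (G x).inverse (Pi.single i 1) j • s j x
  have hs' : ∀ i, IsSmoothOn E F O (s' i) := by
    intro i
    refine ContMDiffOn.sum_section fun j _ => ContMDiffOn.smul_section (fun x hx => ?_)
      ((hs j).mono fun x hx => (hOsub hx).1.1)
    have h1 : ContMDiffAt 𝓘(ℝ, E) 𝓘(ℝ, (Fin k → ℝ) →L[ℝ] (Fin k → ℝ)) ∞
        (fun x => (G x).inverse) x :=
      ((hOsub hx).2.contDiffAt_map_inverse).contMDiffAt.comp x (hGs x (hOsub hx).1)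
    have h2 := h1.clm_apply (contMDiffAt_const (c := Pi.single i (1 : ℝ)))
    exact ((ContinuousLinearMap.proj (R := ℝ) (φ := fun _ : Fin k => ℝ)
      j).contMDiff.contMDiffAt.comp x h2).contMDiffWithinAt
  have hs'J : ∀ i, ∀ x ∈ U, s' i x ∈ J x := fun i x hx => by
    rw [← (hspan x hx).2]
    exact Submodule.sum_mem _ fun j _ => Submodule.smul_mem _ _ (Submodule.subset_span ⟨j, rfl⟩)
  choose t ht hts using fun i => exists_germ hO (hs' i) hxO
  have htJ : ∀ i, t i ∈ secIn E F J := fun i x => by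
    obtain ⟨c, hc, hcs⟩ := hts i x
    rw [hcs]
    by_cases hx : x ∈ O
    · exact (J x).smul_mem _ (hs'J i x (hOsub hx).1.1)
    · rw [hc hx, zero_smul]; exact (J x).zero_mem
  let X : (Fin k → ℝ) →ₗ[ℝ] secIn E F J := Fintype.linearCombination ℝ fun i => ⟨t i, htJ i⟩
  have hX : ∀ c x, (X c).1 x = ∑ i, c i • t i x := by
    intro c x
    change secEval x (X c).1 = _
    simp [X, Fintype.linearCombination_apply, map_sum]
  refine ⟨k, Λ, X, ?_⟩
  filter_upwards [hO.mem_nhds hxO, eventually_all.2 ht] with x hx htx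
  obtain ⟨⟨hxU', hxb⟩, hGx⟩ := hOsub hx
  have hXx : ∀ c, (X c).1 x = ∑ j, (G x).inverse c j • s j x := by
    intro c
    rw [hX]
    simp only [htx, s', Finset.smul_sum, smul_smul]
    rw [Finset.sum_comm]
    refine Finset.sum_congr rfl fun j _ => ?_
    rw [← Finset.sum_smul]
    congr 1
    conv_rhs => rw [pi_eq_sum_univ' c]
    simp [map_sum]
  have hnorm : ∀ c, Λ (toFibre F V x₀ x ((X c).1 x)) = c := by
    intro c
    rw [hXx, ← hPapp]
    exact hGx.self_apply_inverse c
  refine ⟨hnorm, fun v hv => ?_⟩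
  rw [← (hspan x hxU').2, Submodule.mem_span_range_iff_exists_fun] at hv
  obtain ⟨c, rfl⟩ := hv
  rw [← hPapp, hXx]
  change ∑ j, (G x).inverse (G x c) j • s j x = _
  rw [hGx.inverse_apply_self c]

/-- A trivialization of the quotient bundle `V/J` over the set `O`, with typical fibre `W`, together
with a linear family `ε w` of global sections of `V` which over `O` represent the constant
sections. -/
structure QuotTrivialization (J : ∀ x, Submodule ℝ (V x)) (O : Set M) (W : Type*)
    [NormedAddCommGroup W] [NormedSpace ℝ W] where
  /-- the fibrewise identification with the typical fibre -/
  κ : ∀ x, V x ⧸ J x →ₗ[ℝ] W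
  /-- global sections representing the constant sections -/
  ε : W →ₗ[ℝ] Sec E F V
  injective : ∀ x ∈ O, Function.Injective (κ x)
  κ_mk_ε : ∀ x ∈ O, ∀ w, κ x ((J x).mkQ (ε w x)) = w
  contMDiffOn : ∀ a : Sec E F V,
    ContMDiffOn 𝓘(ℝ, E) 𝓘(ℝ, W) ∞ (fun x => κ x ((J x).mkQ (a x))) O

open Classical in
/-- `V/J` is identified near `x₀` with the kernel `W` of the functionals dual to a normalized frame
of `J`: each class has a unique representative in `W`. -/
theorem exists_quotTrivialization {J : ∀ x, Submodule ℝ (V x)} (hJ : IsSubbundle E F J) (x₀ : M) :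
    ∃ (W : Submodule ℝ F) (O : Set M), IsOpen O ∧ x₀ ∈ O ∧
      Nonempty (QuotTrivialization (E := E) (F := F) J O W) := by
  obtain ⟨k, Λ, X, hX⟩ := exists_normalized_frame (E := E) (F := F) hJ x₀
  obtain ⟨f, hf1, hfb⟩ := exists_cutoff (E := E) (baseSet_mem_nhds F V x₀)
  obtain ⟨O, hOsub, hO, hxO⟩ := mem_nhds_iff.1 (inter_mem (baseSet_mem_nhds F V x₀)
    (inter_mem hX hf1))
  let W : Submodule ℝ F := LinearMap.ker (Λ : F →ₗ[ℝ] (Fin k → ℝ))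
  obtain ⟨W', hW'⟩ := W.exists_isCompl
  let pr : F →L[ℝ] W := LinearMap.toContinuousLinearMap (W.projectionOnto W' hW')
  have hpr : ∀ w : W, pr w = w := fun w => Submodule.projectionOnto_apply_left hW' w
  -- subtract the component along the normalized frame of `J`
  let Q : ∀ x, V x →ₗ[ℝ] V x := fun x =>
    LinearMap.id - (secEval x ∘ₗ (secIn E F J).subtype ∘ₗ X ∘ₗ (Λ : F →ₗ[ℝ] (Fin k → ℝ)) ∘ₗ
      toFibre F V x₀ x)
  have hQ : ∀ x v, Q x v = v - (X (Λ (toFibre F V x₀ x v))).1 x := fun _ _ => rfl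
  let κ₀ : ∀ x, V x →ₗ[ℝ] W := fun x => (pr : F →ₗ[ℝ] W) ∘ₗ toFibre F V x₀ x ∘ₗ Q x
  have hQW : ∀ x ∈ O, ∀ v, toFibre F V x₀ x (Q x v) ∈ W := by
    intro x hx v
    change Λ (toFibre F V x₀ x (Q x v)) = 0
    rw [hQ, map_sub, map_sub, ((hOsub hx).2.1).1, sub_self]
  have hker : ∀ x ∈ O, LinearMap.ker (κ₀ x) = J x := by
    intro x hx
    ext v
    rw [LinearMap.mem_ker]
    constructor
    · intro h
      have h1 : toFibre F V x₀ x (Q x v) = 0 := by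
        have := hpr ⟨_, hQW x hx v⟩
        exact (congrArg Subtype.val (h.symm.trans this)).symm
      have h2 : Q x v = 0 := by
        rw [← ofFibre_toFibre (hOsub hx).1 (Q x v), h1, map_zero]
      rw [hQ, sub_eq_zero] at h2
      rw [h2]
      exact (X _).2 x
    · intro h
      change pr (toFibre F V x₀ x (Q x v)) = 0
      rw [hQ, ((hOsub hx).2.1).2 v h, sub_self, map_zero, map_zero]
  let κ : ∀ x, V x ⧸ J x →ₗ[ℝ] W := fun x =>
    if h : J x ≤ LinearMap.ker (κ₀ x) then (J x).liftQ (κ₀ x) h else 0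
  have hκ : ∀ x ∈ O, ∀ v, κ x ((J x).mkQ v) = κ₀ x v := by
    intro x hx v
    simp only [κ, dif_pos (hker x hx).ge]
    rfl
  have hofs : ∀ w : W, IsSmoothOn E F (trivializationAt F V x₀).baseSet
      (fun x => ofFibre F V x₀ x (w : F)) := by
    intro w x hx
    refine ((contMDiffAt_section_iff_toFibre hx _).2 ?_).contMDiffWithinAt
    refine (contMDiffAt_const (c := (w : F))).congr_of_eventuallyEq ?_
    filter_upwards [(trivializationAt F V x₀).open_baseSet.mem_nhds hx] with y hy
    exact toFibre_ofFibre hy _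
  let ε : W →ₗ[ℝ] Sec E F V :=
    { toFun := fun w => ⟨fun x => f x • ofFibre F V x₀ x (w : F),
        ContMDiffOn.smul_section_of_tsupport f.contMDiff.contMDiffOn
          (trivializationAt F V x₀).open_baseSet hfb (hofs w)⟩
      map_add' := fun w w' => by ext x; simp
      map_smul' := fun r w => by
        ext x
        change f x • ofFibre F V x₀ x (r • (w : F)) = r • (f x • ofFibre F V x₀ x (w : F))
        rw [map_smul, smul_comm] }
  refine ⟨W, O, hO, hxO, ⟨⟨κ, ε, fun x hx => ?_, fun x hx w => ?_, fun a => ?_⟩⟩⟩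
  · rw [← LinearMap.ker_eq_bot, LinearMap.ker_eq_bot']
    intro v hv
    obtain ⟨v, rfl⟩ := (J x).mkQ_surjective v
    rw [hκ x hx, ← LinearMap.mem_ker, hker x hx] at hv
    simpa using hv
  · have h1 : ε w x = ofFibre F V x₀ x (w : F) := by
      change f x • ofFibre F V x₀ x (w : F) = _
      rw [show f x = 1 from (hOsub hx).2.2, one_smul]
    have h2 : Λ (w : F) = 0 := w.2
    rw [hκ x hx, h1]
    change pr (toFibre F V x₀ x (Q x _)) = w
    rw [hQ, toFibre_ofFibre (hOsub hx).1, h2, map_zero]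
    change pr (toFibre F V x₀ x (_ - 0)) = w
    rw [sub_zero, toFibre_ofFibre (hOsub hx).1, hpr]
  · intro x hx
    have hsec : ∀ b : Sec E F V, ContMDiffAt 𝓘(ℝ, E) 𝓘(ℝ, F) ∞
        (fun x => toFibre F V x₀ x (b x)) x := fun b =>
      (contMDiffAt_section_iff_toFibre (hOsub hx).1 _).1 (b.contMDiff x)
    have h1 : ContMDiffAt 𝓘(ℝ, E) 𝓘(ℝ, W) ∞ (fun y => pr (toFibre F V x₀ y (a y) -
        ∑ i, Λ (toFibre F V x₀ y (a y)) i •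
          toFibre F V x₀ y ((X (Pi.single i 1)).1 y))) x := by
      refine pr.contMDiff.contMDiffAt.comp x ((hsec a).sub (ContMDiffAt.sum fun i _ => ?_))
      have h2 : ContMDiffAt 𝓘(ℝ, E) 𝓘(ℝ, ℝ) ∞ (fun y => Λ (toFibre F V x₀ y (a y)) i) x :=
        (ContinuousLinearMap.proj (R := ℝ) (φ := fun _ : Fin k => ℝ) i ∘L
          Λ).contMDiff.contMDiffAt.comp x (hsec a)
      exact h2.smul (hsec _)
    refine (h1.congr_of_eventuallyEq ?_).contMDiffWithinAt
    filter_upwards [hO.mem_nhds hx] with y hy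
    rw [hκ y hy]
    change pr (toFibre F V x₀ y (Q y (a y))) = _
    rw [hQ, map_sub]
    congr 2
    change toFibre F V x₀ y (secEval y (X _).1) = _
    conv_lhs => rw [pi_eq_sum_univ' (Λ (toFibre F V x₀ y (a y)))]
    simp [map_sum]

end Frames

/-! ### Partial connections in a trivialization of the quotient bundle -/

section Deriv

variable {E : Type*} [NormedAddCommGroup E] [NormedSpace ℝ E]
  {M : Type*} [TopologicalSpace M] [ChartedSpace E M]
  {W W' : Type*} [NormedAddCommGroup W] [NormedSpace ℝ W]
  [NormedAddCommGroup W'] [NormedSpace ℝ W']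

theorem mvfderiv_congr {g g' : M → W} {x : M} (h : g =ᶠ[𝓝 x] g')
    (v : TangentSpace 𝓘(ℝ, E) x) : mvfderiv 𝓘(ℝ, E) g x v = mvfderiv 𝓘(ℝ, E) g' x v := by
  have h1 := h.mfderiv_eq (I := 𝓘(ℝ, E)) (I' := 𝓘(ℝ, W))
  change (mfderiv 𝓘(ℝ, E) 𝓘(ℝ, W) g x v : W) = (mfderiv 𝓘(ℝ, E) 𝓘(ℝ, W) g' x v : W)
  exact congrArg (fun A : TangentSpace 𝓘(ℝ, E) x →L[ℝ] W => A v) h1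

theorem mvfderiv_clm_comp (A : W →L[ℝ] W') {g : M → W} {x : M}
    (hg : MDifferentiableAt 𝓘(ℝ, E) 𝓘(ℝ, W) g x) (v : TangentSpace 𝓘(ℝ, E) x) :
    mvfderiv 𝓘(ℝ, E) (fun y => A (g y)) x v = A (mvfderiv 𝓘(ℝ, E) g x v) := by
  have h1 := (A.hasMFDerivAt (x := g x)).comp x hg.hasMFDerivAt
  exact congrArg (fun B : TangentSpace 𝓘(ℝ, E) x →L[ℝ] W' => B v) h1.mfderiv

theorem exists_germ_function [FiniteDimensional ℝ E] [T2Space M] [IsManifold 𝓘(ℝ, E) ∞ M]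
    {O : Set M} (hO : IsOpen O) {g : M → ℝ} (hg : ContMDiffOn 𝓘(ℝ, E) 𝓘(ℝ, ℝ) ∞ g O) {x : M}
    (hx : x ∈ O) : ∃ f : C^∞⟮𝓘(ℝ, E), M; ℝ⟯, ∀ᶠ y in 𝓝 x, f y = g y := by
  obtain ⟨χ, hχ1, hχO⟩ := exists_cutoff (E := E) (hO.mem_nhds hx)
  refine ⟨⟨fun y => χ y • g y, contMDiff_of_tsupport fun y hy => ?_⟩, ?_⟩
  · have hyO : y ∈ O := hχO (tsupport_smul_subset_left (χ : M → ℝ) g hy)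
    exact (χ.contMDiff y).smul (hg.contMDiffAt (hO.mem_nhds hyO))
  · filter_upwards [hχ1] with y hy
    change χ y • g y = g y
    rw [hy]
    simp

end Deriv

section Connection

variable {E : Type*} [NormedAddCommGroup E] [NormedSpace ℝ E]
  {M : Type*} [TopologicalSpace M] [ChartedSpace E M]
  {F : Type*} [NormedAddCommGroup F] [NormedSpace ℝ F]
  {V : M → Type*} [TopologicalSpace (Bundle.TotalSpace F V)]
  [∀ x, TopologicalSpace (V x)] [∀ x, AddCommGroup (V x)] [∀ x, Module ℝ (V x)]
  [FiberBundle F V] [VectorBundle ℝ F V]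

/-- Evaluation of sections of the quotient bundle at a point. -/
noncomputable def quotEval (J : ∀ x, Submodule ℝ (V x)) (x : M) :
    quotSec E F J →ₗ[ℝ] V x ⧸ J x where
  toFun σ := σ.1 x
  map_add' _ _ := rfl
  map_smul' _ _ := rfl

variable [FiniteDimensional ℝ E] [T2Space M] [IsManifold 𝓘(ℝ, E) ∞ M]
  {W : Type*} [NormedAddCommGroup W] [NormedSpace ℝ W] [FiniteDimensional ℝ W]
  {J : ∀ x, Submodule ℝ (V x)} {O : Set M}

namespace QuotTrivialization

variable (T : QuotTrivialization (E := E) (F := F) J O W)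

/-- In a trivialization of `V/J`, every section of `V` is near each point a combination of the
constant sections, up to sections of `J`. -/
theorem exists_expansion (hO : IsOpen O) {x : M} (hx : x ∈ O) (a : Sec E F V) {n : ℕ}
    (b : Module.Basis (Fin n) ℝ W) : ∃ f : Fin n → C^∞⟮𝓘(ℝ, E), M; ℝ⟯,
      (∀ᶠ y in 𝓝 x, ∀ i, f i y = b.repr (T.κ y ((J y).mkQ (a y))) i) ∧
      ∀ᶠ y in 𝓝 x, (J y).mkQ (a y) = ∑ i, f i y • (J y).mkQ (T.ε (b i) y) := by
  have hsm : ∀ i, ContMDiffOn 𝓘(ℝ, E) 𝓘(ℝ, ℝ) ∞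
      (fun y => b.repr (T.κ y ((J y).mkQ (a y))) i) O := fun i y hy =>
    ((LinearMap.toContinuousLinearMap (b.coord i)).contMDiff.contMDiffAt.comp y
      ((T.contMDiffOn a).contMDiffAt (hO.mem_nhds hy))).contMDiffWithinAt
  choose f hf using fun i => exists_germ_function hO (hsm i) hx
  refine ⟨f, eventually_all.2 hf, ?_⟩
  filter_upwards [eventually_all.2 hf, hO.mem_nhds hx] with y hy hyO
  refine T.injective y hyO ?_
  simp only [map_sum, map_smul, T.κ_mk_ε y hyO, hy]
  exact (b.sum_repr _).symm

variable {D : ∀ x : M, Submodule ℝ (TangentSpace 𝓘(ℝ, E) x)}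
  (C : PartialConnection (F := F) D J)

/-- The connection coefficients `Γ_X w = ∇_X w` of a partial connection in a trivialization. -/
noncomputable def christoffel (x : M) : secIn E E D →ₗ[ℝ] W →ₗ[ℝ] W :=
  LinearMap.mk₂ ℝ (fun X w => T.κ x ((C.conn X (quotMk J (T.ε w))).1 x))
    (fun _ _ _ => by simp) (fun _ _ _ => by simp) (fun _ _ _ => by simp) (fun _ _ _ => by simp)

omit [FiniteDimensional ℝ E] [T2Space M] [FiniteDimensional ℝ W] in
theorem christoffel_apply (x : M) (X : secIn E E D) (w : W) :
    T.christoffel C x X w = T.κ x ((C.conn X (quotMk J (T.ε w))).1 x) := rfl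

/-- In a trivialization, `∇_X a = X a + Γ_X a`. -/
theorem conn_apply (hO : IsOpen O) {x : M} (hx : x ∈ O) (X : secIn E E D) (a : Sec E F V) :
    T.κ x ((C.conn X (quotMk J a)).1 x) =
      mvfderiv 𝓘(ℝ, E) (fun y => T.κ y ((J y).mkQ (a y))) x (X.1 x) +
        T.christoffel C x X (T.κ x ((J x).mkQ (a x))) := by
  set b := Module.finBasis ℝ W
  obtain ⟨f, hf, hexp⟩ := T.exists_expansion hO hx a b
  set g : M → W := fun y => T.κ y ((J y).mkQ (a y)) with hg
  have hgd : MDifferentiableAt 𝓘(ℝ, E) 𝓘(ℝ, W) g x :=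
    ((T.contMDiffOn a).contMDiffAt (hO.mem_nhds hx)).mdifferentiableAt (by simp)
  have h1 : (C.conn X (quotMk J a)).1 x =
      (C.conn X (∑ i, fsmulQuot (f i) (quotMk J (T.ε (b i))))).1 x := by
    refine C.conn_congr (Eventually.of_forall fun _ => rfl) ?_
    filter_upwards [hexp] with y hy
    change (J y).mkQ (a y) = quotEval J y (∑ i, _)
    rw [hy, map_sum]
    rfl
  have h2 : (C.conn X (∑ i, fsmulQuot (f i) (quotMk J (T.ε (b i))))).1 x =
      ∑ i, (f i x • (C.conn X (quotMk J (T.ε (b i)))).1 x +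
        mvfderiv 𝓘(ℝ, E) (f i) x (X.1 x) • (J x).mkQ (T.ε (b i) x)) := by
    change quotEval J x _ = _
    rw [map_sum, map_sum]
    exact Finset.sum_congr rfl fun i _ => C.leibniz (f i) X _ x
  have h3 : ∀ i, mvfderiv 𝓘(ℝ, E) (f i) x (X.1 x) =
      b.repr (mvfderiv 𝓘(ℝ, E) g x (X.1 x)) i := by
    intro i
    rw [mvfderiv_congr (g := f i) (hf.mono fun y hy => hy i)]
    exact mvfderiv_clm_comp (LinearMap.toContinuousLinearMap (b.coord i)) hgd _
  have h4 : ∀ i, f i x = b.repr (g x) i := hf.self_of_nhds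
  rw [h1, h2]
  simp only [map_sum, map_add, map_smul, T.κ_mk_ε x hx, h3, h4, ← christoffel_apply,
    Finset.sum_add_distrib]
  rw [b.sum_repr, add_comm]
  congr 1
  conv_rhs => rw [show T.κ x ((J x).mkQ (a x)) = g x from rfl, ← b.sum_repr (g x)]
  simp only [map_sum, map_smul]

end QuotTrivialization

/-- The value of `∇_X σ` at a point depends on `X` only through its value there. -/
theorem PartialConnection.conn_eq_of_eq_at {D : ∀ x : M, Submodule ℝ (TangentSpace 𝓘(ℝ, E) x)}
    (hD : IsSubbundle E E D) (C : PartialConnection (F := F) D J) {X X' : secIn E E D} {x : M}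
    (h : X.1 x = X'.1 x) (σ : quotSec E F J) : (C.conn X σ).1 x = (C.conn X' σ).1 x := by
  have : IsManifold 𝓘(ℝ, E) (((⊤ : ℕ∞) : WithTop ℕ∞) + 1) M := ‹IsManifold 𝓘(ℝ, E) ∞ M›
  obtain ⟨k, Λ, Y, hY⟩ := exists_normalized_frame (E := E) (F := E) hD x
  -- expand the difference in the frame; its coefficients vanish at `x`
  let Z : secIn E E D := X - X'
  have hZx : Z.1 x = 0 := by
    change X.1 x - X'.1 x = 0
    rw [h, sub_self]
  set B := trivializationAt E (fun x : M => TangentSpace 𝓘(ℝ, E) x) x with hB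
  have hsm : ∀ i, ContMDiffOn 𝓘(ℝ, E) 𝓘(ℝ, ℝ) ∞ (fun y =>
      Λ (toFibre E (fun x : M => TangentSpace 𝓘(ℝ, E) x) x y (Z.1 y)) i) B.baseSet := by
    intro i y hy
    have h1 := (contMDiffAt_section_iff_toFibre hy _).1 (Z.1.contMDiff y)
    exact ((ContinuousLinearMap.proj (R := ℝ) (φ := fun _ : Fin k => ℝ) i ∘L
        Λ).contMDiff.contMDiffAt.comp y h1).contMDiffWithinAt
  choose g hg using fun i => exists_germ_function B.open_baseSet (hsm i)
    (FiberBundle.mem_baseSet_trivializationAt' x)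
  have h1 : (C.conn Z σ).1 x =
      (C.conn (∑ i, fsmulIn (g i) (Y (Pi.single i 1))) σ).1 x := by
    refine C.conn_congr ?_ (Eventually.of_forall fun _ => rfl)
    filter_upwards [hY, eventually_all.2 hg] with y hy hgy
    change _ = (secEval y ∘ₗ (secIn E E D).subtype) (∑ i, _)
    rw [map_sum]
    conv_lhs => rw [← hy.2 _ (Z.2 y), pi_eq_sum_univ' (Λ _)]
    change (secEval y ∘ₗ (secIn E E D).subtype ∘ₗ Y) _ = _
    rw [map_sum]
    refine Finset.sum_congr rfl fun i _ => ?_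
    change _ = g i y • (Y (Pi.single i 1)).1 y
    rw [hgy i]
    rw [map_smul]
    rfl
  have h2 : (C.conn (∑ i, fsmulIn (g i) (Y (Pi.single i 1))) σ).1 x = 0 := by
    rw [map_sum, LinearMap.sum_apply]
    change quotEval J x _ = 0
    rw [map_sum]
    refine Finset.sum_eq_zero fun i _ => ?_
    rw [C.conn_fsmul]
    change g i x • (C.conn (Y (Pi.single i 1)) σ).1 x = 0
    rw [(hg i).self_of_nhds, hZx, map_zero, map_zero, Pi.zero_apply, zero_smul]
  have h3 : (C.conn Z σ).1 x = (C.conn X σ).1 x - (C.conn X' σ).1 x := by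
    change (C.conn (X - X') σ).1 x = _
    rw [map_sub]
    rfl
  rw [← sub_eq_zero, ← h3, h1, h2]

end Connection

/-! ### Vector fields in a chart -/

section Chart

variable {E : Type*} [NormedAddCommGroup E] [NormedSpace ℝ E]
  {M : Type*} [TopologicalSpace M] [ChartedSpace E M]
  {W : Type*} [NormedAddCommGroup W] [NormedSpace ℝ W]

theorem contDiffAt_comp_chart_symm [IsManifold 𝓘(ℝ, E) ∞ M] (x₀ : M) {g : M → W} {z : E}
    (hz : z ∈ (extChartAt 𝓘(ℝ, E) x₀).target)
    (hg : ContMDiffAt 𝓘(ℝ, E) 𝓘(ℝ, W) ∞ g ((extChartAt 𝓘(ℝ, E) x₀).symm z)) :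
    ContDiffAt ℝ ∞ (fun z => g ((extChartAt 𝓘(ℝ, E) x₀).symm z)) z := by
  have h := (contMDiffOn_extChartAt_symm (I := 𝓘(ℝ, E)) (n := ∞) x₀).contMDiffAt
    ((isOpen_extChartAt_target x₀).mem_nhds hz)
  exact (hg.comp z h).contDiffAt

variable [IsManifold 𝓘(ℝ, E) ∞ M]

/-- The vector field `X` in the chart at `x₀`. -/
noncomputable def chartField (x₀ : M) (X : VectorField E M) (z : E) : E :=
  toFibre E (fun x : M => TangentSpace 𝓘(ℝ, E) x) x₀ ((extChartAt 𝓘(ℝ, E) x₀).symm z)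
    (X ((extChartAt 𝓘(ℝ, E) x₀).symm z))

theorem mem_baseSet_of_mem_target (x₀ : M) {z : E}
    (hz : z ∈ (extChartAt 𝓘(ℝ, E) x₀).target) : (extChartAt 𝓘(ℝ, E) x₀).symm z ∈
      (trivializationAt E (fun x : M => TangentSpace 𝓘(ℝ, E) x) x₀).baseSet := by
  rw [TangentBundle.trivializationAt_baseSet, ← extChartAt_source 𝓘(ℝ, E)]
  exact (extChartAt 𝓘(ℝ, E) x₀).map_target hz

theorem contDiffAt_chartField [FiniteDimensional ℝ E] (x₀ : M) (X : VectorField E M) {z : E}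
    (hz : z ∈ (extChartAt 𝓘(ℝ, E) x₀).target) : ContDiffAt ℝ ∞ (chartField x₀ X) z := by
  have : IsManifold 𝓘(ℝ, E) (((⊤ : ℕ∞) : WithTop ℕ∞) + 1) M := ‹IsManifold 𝓘(ℝ, E) ∞ M›
  exact contDiffAt_comp_chart_symm x₀ hz
    ((contMDiffAt_section_iff_toFibre (mem_baseSet_of_mem_target x₀ hz) _).1 (X.contMDiff _))

theorem chartField_eq_mpullback (x₀ : M) (X : VectorField E M) {z : E}
    (hz : z ∈ (extChartAt 𝓘(ℝ, E) x₀).target) : chartField x₀ X z =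
      VectorField.mpullback 𝓘(ℝ, E) 𝓘(ℝ, E) (extChartAt 𝓘(ℝ, E) x₀).symm (fun x => X x) z := by
  have hs := (extChartAt 𝓘(ℝ, E) x₀).map_target hz
  have : IsManifold 𝓘(ℝ, E) 1 M := IsManifold.of_le (n := ∞) (by norm_cast)
  rw [extChartAt_source] at hs
  have h1 := TangentBundle.continuousLinearMapAt_trivializationAt (𝕜 := ℝ) (I := 𝓘(ℝ, E)) hs
  have h2 := mfderivWithin_extChartAt_symm_comp_mfderiv_extChartAt (I := 𝓘(ℝ, E)) hz
  have h3 := mfderiv_extChartAt_comp_mfderivWithin_extChartAt_symm (I := 𝓘(ℝ, E)) hz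
  rw [modelWithCornersSelf_coe, range_id, mfderivWithin_univ] at h2 h3
  rw [VectorField.mpullback_apply, ContinuousLinearMap.inverse_eq h2 h3, ← h1]
  rfl

theorem lieBracket_chartField [FiniteDimensional ℝ E] (x₀ : M) (X Y : VectorField E M) {z : E}
    (hz : z ∈ (extChartAt 𝓘(ℝ, E) x₀).target) :
    VectorField.lieBracket ℝ (chartField x₀ X) (chartField x₀ Y) z =
      chartField x₀ (vfBracket X Y) z := by
  have : IsManifold 𝓘(ℝ, E) (minSmoothness ℝ 2) M := by
    rw [minSmoothness_of_isRCLikeNormedField]; exact IsManifold.of_le (n := ∞) (by norm_cast)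
  have hev : ∀ X : VectorField E M, chartField x₀ X =ᶠ[𝓝 z]
      VectorField.mpullback 𝓘(ℝ, E) 𝓘(ℝ, E) (extChartAt 𝓘(ℝ, E) x₀).symm (fun x => X x) := by
    intro X
    filter_upwards [(isOpen_extChartAt_target x₀).mem_nhds hz] with y hy
    exact chartField_eq_mpullback x₀ X hy
  have h1 := VectorField.mpullback_mlieBracket (n := ∞) (I := 𝓘(ℝ, E)) (I' := 𝓘(ℝ, E))
    (f := (extChartAt 𝓘(ℝ, E) x₀).symm) (x₀ := z) (V := fun x => X x) (W := fun x => Y x)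
    ((X.contMDiff _).mdifferentiableAt (by simp)) ((Y.contMDiff _).mdifferentiableAt (by simp))
    ((contMDiffOn_extChartAt_symm (I := 𝓘(ℝ, E)) (n := ∞) x₀).contMDiffAt
      ((isOpen_extChartAt_target x₀).mem_nhds hz))
    (by rw [minSmoothness_of_isRCLikeNormedField]; norm_cast)
  have h2 : ∀ A B : ∀ z : E, TangentSpace 𝓘(ℝ, E) z,
      VectorField.mlieBracket 𝓘(ℝ, E) A B z = VectorField.lieBracket ℝ A B z := fun A B => by
    have h3 := congrFun (VectorField.mlieBracketWithin_eq_lieBracketWithin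
      (V := A) (W := B) (s := univ)) z
    rw [VectorField.mlieBracketWithin_univ] at h3
    exact h3.trans (congrFun VectorField.lieBracketWithin_univ z)
  rw [chartField_eq_mpullback x₀ _ hz]
  refine Eq.trans ?_ ((h2 _ _).symm.trans h1.symm)
  exact (hev X).lieBracket_vectorField_eq (hev Y)

theorem fderiv_comp_chart_symm (x₀ : M) (X : VectorField E M) {g : M → W} {z : E}
    (hz : z ∈ (extChartAt 𝓘(ℝ, E) x₀).target)
    (hg : MDifferentiableAt 𝓘(ℝ, E) 𝓘(ℝ, W) g ((extChartAt 𝓘(ℝ, E) x₀).symm z)) :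
    fderiv ℝ (fun z => g ((extChartAt 𝓘(ℝ, E) x₀).symm z)) z (chartField x₀ X z) =
      mvfderiv 𝓘(ℝ, E) g ((extChartAt 𝓘(ℝ, E) x₀).symm z)
        (X ((extChartAt 𝓘(ℝ, E) x₀).symm z)) := by
  have : IsManifold 𝓘(ℝ, E) 1 M := IsManifold.of_le (n := ∞) (by norm_cast)
  have hd := ((contMDiffOn_extChartAt_symm (I := 𝓘(ℝ, E)) (n := ∞) x₀).contMDiffAt
      ((isOpen_extChartAt_target x₀).mem_nhds hz)).mdifferentiableAt (by simp)
  have h1 : ∀ v : E, fderiv ℝ (fun z => g ((extChartAt 𝓘(ℝ, E) x₀).symm z)) z v =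
      mfderiv 𝓘(ℝ, E) 𝓘(ℝ, W) g ((extChartAt 𝓘(ℝ, E) x₀).symm z)
        (mfderiv 𝓘(ℝ, E) 𝓘(ℝ, E) (extChartAt 𝓘(ℝ, E) x₀).symm z v) := fun v => by
    rw [← mfderiv_eq_fderiv]
    exact DFunLike.congr_fun (mfderiv_comp z hg hd) v
  have h2 := mfderivWithin_extChartAt_symm_comp_mfderiv_extChartAt (I := 𝓘(ℝ, E)) hz
  have h3 := mfderiv_extChartAt_comp_mfderivWithin_extChartAt_symm (I := 𝓘(ℝ, E)) hz
  rw [modelWithCornersSelf_coe, range_id, mfderivWithin_univ] at h2 h3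
  rw [chartField_eq_mpullback x₀ X hz, VectorField.mpullback_apply,
    ContinuousLinearMap.inverse_eq h2 h3]
  have h4 := DFunLike.congr_fun h2 (X ((extChartAt 𝓘(ℝ, E) x₀).symm z))
  refine (h1 _).trans ?_
  exact congrArg (mfderiv 𝓘(ℝ, E) 𝓘(ℝ, W) g ((extChartAt 𝓘(ℝ, E) x₀).symm z)) h4

/-- A map which is smooth near a point has the germ of a globally smooth map. -/
theorem exists_contDiff_germ [FiniteDimensional ℝ E] {G : E → W} {z₀ : E} (hG : ∀ᶠ z in 𝓝 z₀, ContDiffAt ℝ ∞ G z) :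
    ∃ G' : E → W, ContDiff ℝ ∞ G' ∧ G' =ᶠ[𝓝 z₀] G := by
  obtain ⟨χ, hχ1, hχ⟩ := exists_cutoff (E := E) (M := E) hG
  refine ⟨fun z => χ z • G z, contMDiff_iff_contDiff.1 (contMDiff_of_tsupport fun z hz => ?_), ?_⟩
  · exact (χ.contMDiff z).smul
      (ContDiffAt.contMDiffAt (hχ (tsupport_smul_subset_left (χ : E → ℝ) G hz)))
  · filter_upwards [hχ1] with z hz
    rw [hz, Pi.one_apply, one_smul]

end Chart

/-! ### Local parallel sections of flat partial connections -/

section Parallel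

variable {E : Type*} [NormedAddCommGroup E] [NormedSpace ℝ E] [FiniteDimensional ℝ E]
  {M : Type*} [TopologicalSpace M] [ChartedSpace E M] [IsManifold 𝓘(ℝ, E) ∞ M]
  {F : Type*} [NormedAddCommGroup F] [NormedSpace ℝ F]
  {V : M → Type*} [TopologicalSpace (Bundle.TotalSpace F V)]
  [∀ x, TopologicalSpace (V x)] [∀ x, AddCommGroup (V x)] [∀ x, Module ℝ (V x)]
  [FiberBundle F V] [VectorBundle ℝ F V]
  {J : ∀ x, Submodule ℝ (V x)} {D : ∀ x : M, Submodule ℝ (TangentSpace 𝓘(ℝ, E) x)}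

/-- The members of a normalized frame of an involutive distribution commute: their brackets lie
in the distribution, but have vanishing components along the frame. -/
theorem vfBracket_normalized_frame (hDinv : IsInvolutive D) {x₀ x : M} {k : ℕ}
    {Λ : E →L[ℝ] (Fin k → ℝ)} {X : (Fin k → ℝ) →ₗ[ℝ] secIn E E D}
    (hx : x ∈ (extChartAt 𝓘(ℝ, E) x₀).source)
    (hX : ∀ᶠ y in 𝓝 x,
      (∀ c, Λ (toFibre E (fun x : M => TangentSpace 𝓘(ℝ, E) x) x₀ y ((X c).1 y)) = c) ∧
      ∀ v ∈ D y, (X (Λ (toFibre E (fun x : M => TangentSpace 𝓘(ℝ, E) x) x₀ y v))).1 y = v)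
    (c d : Fin k → ℝ) : vfBracket (X c).1 (X d).1 x = 0 := by
  obtain ⟨z, hz, rfl⟩ : ∃ z ∈ (extChartAt 𝓘(ℝ, E) x₀).target,
      (extChartAt 𝓘(ℝ, E) x₀).symm z = x :=
    ⟨_, (extChartAt 𝓘(ℝ, E) x₀).map_source hx, (extChartAt 𝓘(ℝ, E) x₀).left_inv hx⟩
  have hcont : ContinuousAt (extChartAt 𝓘(ℝ, E) x₀).symm z :=
    (continuousOn_extChartAt_symm x₀).continuousAt ((isOpen_extChartAt_target x₀).mem_nhds hz)
  have h1 : ∀ (e : Fin k → ℝ) (u : E), Λ (fderiv ℝ (chartField x₀ (X e).1) z u) = 0 := by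
    intro e u
    have h2 : (fun y => Λ (chartField x₀ (X e).1 y)) =ᶠ[𝓝 z] fun _ => e := by
      filter_upwards [hcont.eventually hX] with y hy using hy.1 e
    have h3 := h2.fderiv_eq (𝕜 := ℝ)
    have h4 : HasFDerivAt (fun y => Λ (chartField x₀ (X e).1 y))
        (Λ ∘L fderiv ℝ (chartField x₀ (X e).1) z) z :=
      Λ.hasFDerivAt.comp z
        ((contDiffAt_chartField x₀ (X e).1 hz).differentiableAt (by simp)).hasFDerivAt
    rw [h4.fderiv, fderiv_fun_const] at h3
    exact DFunLike.congr_fun h3 u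
  have h5 : Λ (chartField x₀ (vfBracket (X c).1 (X d).1) z) = 0 := by
    rw [← lieBracket_chartField x₀ _ _ hz, VectorField.lieBracket_eq]
    change Λ (_ - _) = 0
    rw [map_sub, h1, h1, sub_self]
  have h6 := hX.self_of_nhds.2 _ (hDinv (X c).1 (X c).2 (X d).1 (X d).2 _)
  change (X (Λ (chartField x₀ (vfBracket (X c).1 (X d).1) z))).1 _ = _ at h6
  rw [← h6, h5, map_zero]
  rfl

variable {W : Type*} [NormedAddCommGroup W] [NormedSpace ℝ W]
  [T2Space M] [SigmaCompactSpace M] {O : Set M}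

namespace QuotTrivialization

variable (T : QuotTrivialization (E := E) (F := F) J O W) (C : PartialConnection (F := F) D J)

theorem contMDiffAt_christoffel
    (hO : IsOpen O) {x : M} (hx : x ∈ O) (X : secIn E E D) (w : W) :
    ContMDiffAt 𝓘(ℝ, E) 𝓘(ℝ, W) ∞ (fun y => T.christoffel C y X w) x := by
  obtain ⟨a, ha⟩ := quotMk_surjective J (C.conn X (quotMk J (T.ε w)))
  have h := (T.contMDiffOn a).contMDiffAt (hO.mem_nhds hx)
  simp only [christoffel_apply, ← ha]
  exact h

variable [FiniteDimensional ℝ W]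

/-- Flatness in terms of the connection coefficients, for commuting vector fields. -/
theorem christoffel_flat
    (hO : IsOpen O) {x : M} (hx : x ∈ O) {hDinv : IsInvolutive D}
    (hC : C.IsFlat hDinv) {X Y : secIn E E D} (hXY : ∀ᶠ y in 𝓝 x, vfBracket X.1 Y.1 y = 0)
    (w : W) :
    mvfderiv 𝓘(ℝ, E) (fun y => T.christoffel C y Y w) x (X.1 x) +
        T.christoffel C x X (T.christoffel C x Y w) =
      mvfderiv 𝓘(ℝ, E) (fun y => T.christoffel C y X w) x (Y.1 x) +
        T.christoffel C x Y (T.christoffel C x X w) := by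
  have key : ∀ X Y : secIn E E D,
      mvfderiv 𝓘(ℝ, E) (fun y => T.christoffel C y Y w) x (X.1 x) +
        T.christoffel C x X (T.christoffel C x Y w) =
      T.κ x ((C.conn X (C.conn Y (quotMk J (T.ε w)))).1 x) := by
    intro X Y
    obtain ⟨a, ha⟩ := quotMk_surjective J (C.conn Y (quotMk J (T.ε w)))
    have h := T.conn_apply C hO hx X a
    rw [← ha, h]
    simp only [christoffel_apply, ← ha]
    rfl
  rw [key, key]
  congr 1
  have h1 := congrArg (fun σ : quotSec E F J => σ.1 x) (hC X Y (quotMk J (T.ε w)))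
  have h2 : (C.conn ⟨vfBracket X.1 Y.1, hDinv X.1 X.2 Y.1 Y.2⟩ (quotMk J (T.ε w))).1 x =
      (C.conn 0 (quotMk J (T.ε w))).1 x :=
    C.conn_congr hXY (Eventually.of_forall fun _ => rfl)
  rw [map_zero] at h2
  exact sub_eq_zero.1 (h1.trans h2)

end QuotTrivialization

end Parallel

section Evaluation

theorem contDiffAt_clm_of_apply {E' G W : Type*} [NormedAddCommGroup E'] [NormedSpace ℝ E']
    [NormedAddCommGroup G] [NormedSpace ℝ G] [FiniteDimensional ℝ G]
    [NormedAddCommGroup W] [NormedSpace ℝ W] {B : E' → G →L[ℝ] W} {z : E'}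
    (h : ∀ᶠ y in 𝓝 z, ∀ c, ContDiffAt ℝ ∞ (fun y => B y c) y) : ContDiffAt ℝ ∞ B z := by
  obtain ⟨U, hUsub, hU, hz⟩ := mem_nhds_iff.1 h
  exact (contDiffOn_clm_apply.2 fun c y hy => (hUsub hy c).contDiffWithinAt).contDiffAt
    (hU.mem_nhds hz)

theorem fderiv_apply_const {E' G W : Type*} [NormedAddCommGroup E'] [NormedSpace ℝ E']
    [NormedAddCommGroup G] [NormedSpace ℝ G] [NormedAddCommGroup W] [NormedSpace ℝ W]
    {Γ : E' → G →L[ℝ] W} {z : E'} (h : DifferentiableAt ℝ Γ z) (d : G) (u : E') :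
    fderiv ℝ (fun y => Γ y d) z u = fderiv ℝ Γ z u d := by
  rw [fderiv_clm_apply h (differentiableAt_const d)]
  simp

end Evaluation

section Parallel

variable {E : Type*} [NormedAddCommGroup E] [NormedSpace ℝ E] [FiniteDimensional ℝ E]
  {M : Type*} [TopologicalSpace M] [T2Space M] [SigmaCompactSpace M] [ChartedSpace E M]
  [IsManifold 𝓘(ℝ, E) ∞ M]
  {F : Type*} [NormedAddCommGroup F] [NormedSpace ℝ F]
  {V : M → Type*} [TopologicalSpace (Bundle.TotalSpace F V)]
  [∀ x, TopologicalSpace (V x)] [∀ x, AddCommGroup (V x)] [∀ x, Module ℝ (V x)]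
  [FiberBundle F V] [VectorBundle ℝ F V]
  {J : ∀ x, Submodule ℝ (V x)} {D : ∀ x : M, Submodule ℝ (TangentSpace 𝓘(ℝ, E) x)}

/-- The key point: locally, a flat partial connection has parallel sections through every value.
In a chart and a trivialization, with respect to a commuting frame of the distribution, the
equation for parallel sections is the flat linear system of `exists_parallel_of_flat`. -/
theorem QuotTrivialization.exists_parallel_section {W : Type*} [NormedAddCommGroup W]
    [NormedSpace ℝ W] [FiniteDimensional ℝ W] {O : Set M}
    (T : QuotTrivialization (E := E) (F := F) J O W) (hO : IsOpen O)
    (hD : IsSubbundle E E D) {hDinv : IsInvolutive D}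
    (C : PartialConnection (F := F) D J) (hC : C.IsFlat hDinv)
    {x₀ : M} (hxO : x₀ ∈ O) (v : V x₀) :
    ∃ U : Set M, IsOpen U ∧ x₀ ∈ U ∧ ∃ a : ∀ x, V x, IsSmoothOn E F U a ∧
      C.IsParallelOn U a ∧ (J x₀).mkQ (a x₀) = (J x₀).mkQ v := by
  have : IsManifold 𝓘(ℝ, E) (((⊤ : ℕ∞) : WithTop ℕ∞) + 1) M := ‹IsManifold 𝓘(ℝ, E) ∞ M›
  obtain ⟨k, Λ, X, hX⟩ := exists_normalized_frame (E := E) (F := E) hD x₀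
  set φ := extChartAt 𝓘(ℝ, E) x₀ with hφ
  set z₀ : E := φ x₀ with hz₀
  have hback : Tendsto φ.symm (𝓝 z₀) (𝓝 x₀) := by
    have h := continuousAt_extChartAt_symm (I := 𝓘(ℝ, E)) x₀
    rwa [ContinuousAt, extChartAt_to_inv] at h
  have htarget : ∀ᶠ z in 𝓝 z₀, z ∈ φ.target :=
    (isOpen_extChartAt_target x₀).mem_nhds (mem_extChartAt_target x₀)
  -- the coordinate expressions of the frame and of the connection coefficients
  let B₀ : E → (Fin k → ℝ) →L[ℝ] E := fun z => LinearMap.toContinuousLinearMap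
    (toFibre E (fun x : M => TangentSpace 𝓘(ℝ, E) x) x₀ (φ.symm z) ∘ₗ secEval (φ.symm z) ∘ₗ
      (secIn E E D).subtype ∘ₗ X)
  let Γ₀ : E → (Fin k → ℝ) →L[ℝ] W →L[ℝ] W := fun z => LinearMap.toContinuousLinearMap
    ((LinearMap.toContinuousLinearMap : (W →ₗ[ℝ] W) ≃ₗ[ℝ] (W →L[ℝ] W)).toLinearMap ∘ₗ
      T.christoffel C (φ.symm z) ∘ₗ X)
  have hB₀ : ∀ c, (fun z => B₀ z c) = chartField x₀ (X c).1 := fun c => rfl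
  have hΓ₀ : ∀ z c w, Γ₀ z c w = T.christoffel C (φ.symm z) (X c) w := fun _ _ _ => rfl
  have hB₀s : ∀ᶠ z in 𝓝 z₀, ContDiffAt ℝ ∞ B₀ z := by
    filter_upwards [htarget.eventually_nhds] with z hz
    refine contDiffAt_clm_of_apply (hz.mono fun y hy c => ?_)
    rw [hB₀]
    exact contDiffAt_chartField x₀ _ hy
  have hOz : ∀ᶠ z in 𝓝 z₀, φ.symm z ∈ O := hback.eventually (hO.mem_nhds hxO)
  have hΓs : ∀ c w, ∀ z ∈ φ.target, φ.symm z ∈ O → ContDiffAt ℝ ∞ (fun z => Γ₀ z c w) z :=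
    fun c w z hz hzO => contDiffAt_comp_chart_symm x₀ hz (T.contMDiffAt_christoffel C hO hzO _ w)
  have hΓ₀s : ∀ᶠ z in 𝓝 z₀, ContDiffAt ℝ ∞ Γ₀ z := by
    filter_upwards [(htarget.and hOz).eventually_nhds] with z hz
    refine contDiffAt_clm_of_apply (hz.eventually_nhds.mono fun y hy c => ?_)
    exact contDiffAt_clm_of_apply (hy.mono fun y hy w => hΓs c w y hy.1 hy.2)
  obtain ⟨B, hB, hBB₀⟩ := exists_contDiff_germ hB₀s
  obtain ⟨Γ, hΓ, hΓΓ₀⟩ := exists_contDiff_germ hΓ₀s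
  have hXz := hback.eventually hX.eventually_nhds
  -- derivatives of the coordinate expressions
  have hdB : ∀ z ∈ φ.target, ContDiffAt ℝ ∞ B₀ z → ∀ u c,
      fderiv ℝ B₀ z u c = fderiv ℝ (chartField x₀ (X c).1) z u := by
    intro z hz hs u c
    exact (fderiv_apply_const (hs.differentiableAt (by simp)) c u).symm
  have hdΓ : ∀ z ∈ φ.target, φ.symm z ∈ O → ContDiffAt ℝ ∞ Γ₀ z → ∀ c d w,
      fderiv ℝ Γ₀ z (B₀ z c) d w =
        mvfderiv 𝓘(ℝ, E) (fun y => T.christoffel C y (X d) w) (φ.symm z) ((X c).1 (φ.symm z)) := by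
    intro z hz hzO hs c d w
    have h' := fderiv_comp_chart_symm x₀ (X c).1 hz
      ((T.contMDiffAt_christoffel C hO hzO (X d) w).mdifferentiableAt (by simp))
    refine Eq.trans ?_ h'
    have hd := hs.differentiableAt (by simp)
    have hd' : DifferentiableAt ℝ (fun z => Γ₀ z d) z := hd.clm_apply (differentiableAt_const d)
    rw [← fderiv_apply_const hd]
    exact (fderiv_apply_const hd' w _).symm
  have hBz : ∀ᶠ z in 𝓝 z₀, ∀ c, Λ (B₀ z c) = c := hXz.mono fun z hz => hz.self_of_nhds.1
  have hcomm : ∀ᶠ z in 𝓝 z₀, ∀ᶠ x in 𝓝 (φ.symm z), ∀ c d, vfBracket (X c).1 (X d).1 x = 0 := by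
    filter_upwards [hXz, htarget] with z hz hzt
    filter_upwards [hz.eventually_nhds,
      (isOpen_extChartAt_source (I := 𝓘(ℝ, E)) x₀).mem_nhds (φ.map_target hzt)] with x hx hxs c d
    exact vfBracket_normalized_frame hDinv hxs hx c d
  obtain ⟨S, hS₀, hS⟩ := exists_parallel_of_flat B hB Γ hΓ Λ z₀
    (by filter_upwards [hBB₀, hBz] with z hz h c; rw [hz, h])
    (by
      filter_upwards [hBB₀.eventually_nhds, hB₀s, htarget, hcomm] with z hz hs hzt hc c d
      have hz' : B =ᶠ[𝓝 z] B₀ := hz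
      rw [hz'.fderiv_eq, hz'.self_of_nhds, hdB z hzt hs, hdB z hzt hs]
      have h := lieBracket_chartField x₀ (X c).1 (X d).1 hzt
      rw [VectorField.lieBracket_eq] at h
      refine sub_eq_zero.1 (h.trans ?_)
      change toFibre _ _ _ _ (vfBracket (X c).1 (X d).1 (φ.symm z)) = 0
      rw [hc.self_of_nhds c d, map_zero])
    (by
      filter_upwards [hBB₀, hΓΓ₀.eventually_nhds, hΓ₀s, htarget, hOz, hcomm]
        with z hz hzΓ hs hzt hzO hc c d w
      have hz' : Γ =ᶠ[𝓝 z] Γ₀ := hzΓ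
      rw [hz'.fderiv_eq, hz'.self_of_nhds, hz, hdΓ z hzt hzO hs, hdΓ z hzt hzO hs]
      exact T.christoffel_flat C hO hzO hC (hc.mono fun y hy => hy c d) w)
    (T.κ x₀ ((J x₀).mkQ v))
  -- transport the solution back to the manifold
  obtain ⟨N, hNsub, hN, hzN⟩ := mem_nhds_iff.1 (hS.and (hBB₀.and (hΓΓ₀.and (hOz.and hXz))))
  have hUopen : IsOpen (φ.source ∩ φ ⁻¹' N) := (continuousOn_extChartAt x₀).isOpen_inter_preimage
    (isOpen_extChartAt_source x₀) hN
  have hsmooth : IsSmoothOn E F (φ.source ∩ φ ⁻¹' N) (fun x => T.ε (S (φ x)) x) := by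
    have hSφ : ContMDiffOn 𝓘(ℝ, E) 𝓘(ℝ, W) ∞ (fun x => S (φ x)) (φ.source ∩ φ ⁻¹' N) := by
      intro x hx
      exact ((hNsub hx.2).1.1.contMDiffAt.comp x (contMDiffAt_extChartAt' (by
        rw [← extChartAt_source 𝓘(ℝ, E)]; exact hx.1))).contMDiffWithinAt
    let b := Module.finBasis ℝ W
    have hexp : ∀ x, T.ε (S (φ x)) x = ∑ i, b.repr (S (φ x)) i • T.ε (b i) x := by
      intro x
      change secEval x (T.ε (S (φ x))) = _
      conv_lhs => rw [← b.sum_repr (S (φ x))]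
      simp only [map_sum, map_smul]
      rfl
    rw [funext hexp]
    refine ContMDiffOn.sum_section fun i _ => ContMDiffOn.smul_section (fun x hx => ?_)
      (T.ε (b i)).contMDiff.contMDiffOn
    exact (LinearMap.toContinuousLinearMap (b.coord i)).contMDiff.contMDiffAt.comp_contMDiffWithinAt
      x (hSφ x hx)
  refine ⟨φ.source ∩ φ ⁻¹' N, hUopen, ⟨mem_extChartAt_source x₀, hzN⟩,
    fun x => T.ε (S (φ x)) x, hsmooth, ?_, ?_⟩
  · intro Y hY hYD x hx
    obtain ⟨Y', hY', hYm⟩ := exists_germ hUopen hY hx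
    obtain ⟨a', ha', -⟩ := exists_germ hUopen hsmooth hx
    have hY'D : Y' ∈ secIn E E D := fun y => by
      obtain ⟨r, hr, hrY⟩ := hYm y
      rw [hrY]
      by_cases hy : y ∈ φ.source ∩ φ ⁻¹' N
      · exact (D y).smul_mem _ (hYD y hy)
      · rw [hr hy, zero_smul]; exact (D y).zero_mem
    rw [C.localConn_eq ⟨Y', hY'D⟩ (quotMk J a') hY'
      (ha'.mono fun y hy => congrArg (J y).mkQ hy)]
    obtain ⟨z, hz, rfl⟩ : ∃ z ∈ φ.target, φ.symm z = x :=
      ⟨_, φ.map_source hx.1, φ.left_inv hx.1⟩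
    have hφz : φ (φ.symm z) = z := φ.right_inv hz
    have hzN : z ∈ N := by simpa [hφz] using hx.2
    obtain ⟨⟨hSs, hSz⟩, hBz, hΓz, hzO, hXz⟩ := hNsub hzN
    set c := Λ (toFibre E (fun x : M => TangentSpace 𝓘(ℝ, E) x) x₀ (φ.symm z) (Y' (φ.symm z)))
    rw [C.conn_eq_of_eq_at hD (X' := X c) (hXz.self_of_nhds.2 _ (hY'D _)).symm]
    refine T.injective _ hzO ?_
    have hκ : (fun y => T.κ y ((J y).mkQ (a' y))) =ᶠ[𝓝 (φ.symm z)] fun y => S (φ y) := by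
      filter_upwards [ha', hO.mem_nhds hzO] with y hy hyO
      rw [hy, T.κ_mk_ε y hyO]
    have hd : MDifferentiableAt 𝓘(ℝ, E) 𝓘(ℝ, W) (fun y => T.κ y ((J y).mkQ (a' y))) (φ.symm z) :=
      ((T.contMDiffOn a').contMDiffAt (hO.mem_nhds hzO)).mdifferentiableAt (by simp)
    have hcont : ContinuousAt φ.symm z :=
      (continuousOn_extChartAt_symm x₀).continuousAt ((isOpen_extChartAt_target x₀).mem_nhds hz)
    have hκS : (fun y => T.κ (φ.symm y) ((J (φ.symm y)).mkQ (a' (φ.symm y)))) =ᶠ[𝓝 z] S := by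
      filter_upwards [hcont.eventually hκ, (isOpen_extChartAt_target x₀).mem_nhds hz] with y hy hyt
      rw [hy, φ.right_inv hyt]
    have hκz : T.κ (φ.symm z) ((J (φ.symm z)).mkQ (a' (φ.symm z))) = S z := hκS.self_of_nhds
    rw [map_zero, T.conn_apply C hO hzO, hκz,
      ← fderiv_comp_chart_symm x₀ (X c).1 hz hd, hκS.fderiv_eq]
    have h := hSz c
    rwa [hBz, hΓz] at h
  · refine T.injective x₀ hxO ?_
    rw [T.κ_mk_ε x₀ hxO]
    exact hS₀

theorem exists_parallel_section [FiniteDimensional ℝ F] [ContMDiffVectorBundle ∞ F V 𝓘(ℝ, E)]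
    (hD : IsSubbundle E E D) {hDinv : IsInvolutive D}
    (hJ : IsSubbundle E F J) (C : PartialConnection (F := F) D J) (hC : C.IsFlat hDinv)
    (x₀ : M) (v : V x₀) :
    ∃ U : Set M, IsOpen U ∧ x₀ ∈ U ∧ ∃ a : ∀ x, V x, IsSmoothOn E F U a ∧
      C.IsParallelOn U a ∧ (J x₀).mkQ (a x₀) = (J x₀).mkQ v := by
  obtain ⟨W, O, hO, hxO, ⟨T⟩⟩ := exists_quotTrivialization (E := E) (F := F) hJ x₀
  exact T.exists_parallel_section hO hD C hC hxO v

end Parallel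

/-! ### Comparison with the Bott connection -/

section Comparison

variable {E : Type*} [NormedAddCommGroup E] [NormedSpace ℝ E]
  {M : Type*} [TopologicalSpace M] [ChartedSpace E M] [IsManifold 𝓘(ℝ, E) ∞ M]
  {F : Type*} [NormedAddCommGroup F] [NormedSpace ℝ F]
  {V : M → Type*} [TopologicalSpace (Bundle.TotalSpace F V)]
  [∀ x, TopologicalSpace (V x)] [∀ x, AddCommGroup (V x)] [∀ x, Module ℝ (V x)]
  [FiberBundle F V] [VectorBundle ℝ F V]
  {J : ∀ x, Submodule ℝ (V x)} {D : ∀ x : M, Submodule ℝ (TangentSpace 𝓘(ℝ, E) x)}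

variable (L : LieAlgebroid E F V) (C : PartialConnection (F := F) D J)
  (hρ : ∀ x, ∀ v ∈ J x, L.anchor x v ∈ D x)

/-- The difference `∇^J_j ā - ∇_{ρ(j)} ā` at the point `x`, as a linear map of the section `a`. -/
noncomputable def defect (j : secIn E F J) (x : M) : Sec E F V →ₗ[ℝ] V x ⧸ J x :=
  (J x).mkQ ∘ₗ secEval x ∘ₗ L.bracket j.1 -
    quotEval J x ∘ₗ C.conn (L.anchorIn hρ j) ∘ₗ quotMk J

theorem defect_apply (j : secIn E F J) (x : M) (a : Sec E F V) :
    defect L C hρ j x a = (J x).mkQ (L.bracket j.1 a x) -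
      (C.conn (L.anchorIn hρ j) (quotMk J a)).1 x := rfl

/-- The derivative terms of the two Leibniz rules cancel. -/
theorem defect_fsmul (j : secIn E F J) (x : M) (f : C^∞⟮𝓘(ℝ, E), M; ℝ⟯) (a : Sec E F V) :
    defect L C hρ j x (fsmul f a) = f x • defect L C hρ j x a := by
  have h1 : quotMk J (fsmul f a) = fsmulQuot f (quotMk J a) := by
    refine Subtype.ext (funext fun y => ?_)
    change (J y).mkQ (f y • a y) = f y • (J y).mkQ (a y)
    rw [map_smul]
  rw [defect_apply, defect_apply, L.leibniz, h1, C.leibniz, map_add, map_smul, map_smul, smul_sub]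
  exact add_sub_add_right_eq_sub _ _ _

theorem defect_of_mem (hJ : L.IsSubalgebroid J) (j a : secIn E F J) (x : M) :
    defect L C hρ j x a.1 = 0 := by
  have h1 : quotMk J a.1 = 0 :=
    Subtype.ext (funext fun y => (Submodule.Quotient.mk_eq_zero _).2 (a.2 y))
  have h2 : (J x).mkQ (L.bracket j.1 a.1 x) = 0 :=
    (Submodule.Quotient.mk_eq_zero _).2 (hJ.bracket_mem j.1 j.2 a.1 a.2 x)
  rw [defect_apply, h1, h2, map_zero]
  exact sub_zero _

variable [FiniteDimensional ℝ E] [T2Space M]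

/-- A section of a subbundle over an open set has the germ of a global section of it. -/
theorem exists_germ_secIn {U : Set M} (hU : IsOpen U) {s : ∀ x, V x} (hs : IsSmoothOn E F U s)
    (hsJ : ∀ x ∈ U, s x ∈ J x) {x : M} (hx : x ∈ U) :
    ∃ t : secIn E F J, ∀ᶠ y in 𝓝 x, t.1 y = s y := by
  obtain ⟨t, ht, htm⟩ := exists_germ hU hs hx
  refine ⟨⟨t, fun y => ?_⟩, ht⟩
  obtain ⟨r, hr, hrs⟩ := htm y
  rw [hrs]
  by_cases hy : y ∈ U
  · exact (J y).smul_mem _ (hsJ y hy)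
  · rw [hr hy, zero_smul]
    exact (J y).zero_mem

theorem defect_congr (j : secIn E F J) {x : M} {a a' : Sec E F V}
    (h : ∀ᶠ y in 𝓝 x, a y = a' y) : defect L C hρ j x a = defect L C hρ j x a' := by
  rw [defect_apply, defect_apply, L.bracket_congr_right j.1 h]
  congr 1
  exact C.conn_congr (Eventually.of_forall fun _ => rfl)
    (h.mono fun y hy => congrArg (J y).mkQ hy)

variable [FiniteDimensional ℝ F] [ContMDiffVectorBundle ∞ F V 𝓘(ℝ, E)]

/-- The difference of the two connections is tensorial: it only depends on the value of `ā` at the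
point. -/
theorem defect_eq_zero_of_mem_at (hJ : L.IsSubalgebroid J) (j : secIn E F J) {x : M}
    {a : Sec E F V} (ha : a x ∈ J x) : defect L C hρ j x a = 0 := by
  obtain ⟨W, O, hO, hxO, ⟨T⟩⟩ := exists_quotTrivialization (E := E) (F := F) hJ.subbundle x
  let b := Module.finBasis ℝ W
  obtain ⟨f, hf, hexp⟩ := T.exists_expansion hO hxO a b
  have hfx : ∀ i, f i x = 0 := fun i => by
    have h0 : (J x).mkQ (a x) = 0 := (Submodule.Quotient.mk_eq_zero _).2 ha
    rw [hf.self_of_nhds i, h0, map_zero, map_zero]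
    rfl
  -- near `x` the remainder of the expansion of `a` is a section of `J`
  set r : Sec E F V := a - ∑ i, fsmul (f i) (T.ε (b i)) with hr
  have hrJ : ∀ᶠ y in 𝓝 x, r y ∈ J y := by
    filter_upwards [hexp] with y hy
    have h1 : r y = a y - ∑ i, f i y • T.ε (b i) y := by
      change secEval y (a - ∑ i, fsmul (f i) (T.ε (b i))) = _
      rw [map_sub, map_sum]
      rfl
    rw [← Submodule.Quotient.mk_eq_zero, ← Submodule.mkQ_apply, h1, map_sub, hy, map_sum]
    simp only [map_smul, sub_self]
  obtain ⟨U, hUsub, hU, hxU⟩ := mem_nhds_iff.1 hrJ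
  obtain ⟨r', hr'⟩ := exists_germ_secIn (J := J) hU (r.contMDiff.contMDiffOn : IsSmoothOn E F U r)
    (fun y hy => hUsub hy) hxU
  have h2 : defect L C hρ j x r = 0 := by
    rw [← defect_congr L C hρ j hr']
    exact defect_of_mem L C hρ hJ j r' x
  have h3 : defect L C hρ j x (∑ i, fsmul (f i) (T.ε (b i))) = 0 := by
    rw [map_sum]
    refine Finset.sum_eq_zero fun i _ => ?_
    rw [defect_fsmul, hfx, zero_smul]
  rw [hr, map_sub, h3, sub_zero] at h2
  exact h2

end Comparison

end LieAlgd

theorem mainTheorem4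
    {E : Type*} [NormedAddCommGroup E] [NormedSpace ℝ E] [FiniteDimensional ℝ E]
    {M : Type*} [TopologicalSpace M] [T2Space M] [SigmaCompactSpace M]
    [ChartedSpace E M] [IsManifold 𝓘(ℝ, E) ∞ M]
    {F : Type*} [NormedAddCommGroup F] [NormedSpace ℝ F] [FiniteDimensional ℝ F]
    {A : M → Type*} [TopologicalSpace (Bundle.TotalSpace F A)]
    [∀ x, TopologicalSpace (A x)] [∀ x, AddCommGroup (A x)] [∀ x, Module ℝ (A x)]
    [FiberBundle F A] [VectorBundle ℝ F A] [ContMDiffVectorBundle ∞ F A 𝓘(ℝ, E)]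
    (L : LieAlgd.LieAlgebroid E F A)
    (D : ∀ x : M, Submodule ℝ (TangentSpace 𝓘(ℝ, E) x))
    (_hD : LieAlgd.IsSubbundle E E D) (hDinv : LieAlgd.IsInvolutive D)
    (J : ∀ x, Submodule ℝ (A x)) (hJ : L.IsSubalgebroid J)
    (hρ : ∀ x, ∀ v ∈ J x, L.anchor x v ∈ D x)
    (C : LieAlgd.PartialConnection (F := F) D J) (_hC : C.IsFlat hDinv) :
    (∀ U : Set M, IsOpen U →
      ∀ a : (∀ x, A x), LieAlgd.IsSmoothOn E F U a → C.IsParallelOn U a →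
      ∀ j : (∀ x, A x), LieAlgd.IsSmoothOn E F U j → (∀ x ∈ U, j x ∈ J x) →
      ∀ x ∈ U, L.localBracket a j x ∈ J x) ↔
    (∀ (j : LieAlgd.secIn E F J) (a : LieAlgd.Sec E F A),
      L.bott hJ j (LieAlgd.quotMk J a) = C.conn (L.anchorIn hρ j) (LieAlgd.quotMk J a)) := by
  constructor
  · intro h j a
    rw [L.bott_quotMk hJ]
    refine Subtype.ext (funext fun x => ?_)
    obtain ⟨U, hU, hxU, s, hs, hpar, hsx⟩ :=
      LieAlgd.exists_parallel_section _hD hJ.subbundle C _hC x (a x)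
    obtain ⟨a', ha', -⟩ := LieAlgd.exists_germ hU hs hxU
    -- the difference of the connections vanishes on the parallel section with the same value
    have h1 : LieAlgd.defect L C hρ j x a' = 0 := by
      have h2 := h U hU s hs hpar j.1 j.1.contMDiff.contMDiffOn (fun y _ => j.2 y) x hxU
      rw [L.localBracket_eq a' j.1 ha' (Eventually.of_forall fun _ => rfl), L.bracket_swap] at h2
      have h3 := hpar (L.anchorIn hρ j).1 (L.anchorIn hρ j).1.contMDiff.contMDiffOn
        (fun y _ => (L.anchorIn hρ j).2 y) x hxU
      rw [C.localConn_eq (L.anchorIn hρ j) (LieAlgd.quotMk J a')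
        (Eventually.of_forall fun _ => rfl) (ha'.mono fun y hy => congrArg (J y).mkQ hy)] at h3
      rw [LieAlgd.defect_apply, h3, sub_zero]
      exact (Submodule.Quotient.mk_eq_zero _).2 ((Submodule.neg_mem_iff _).1 h2)
    have h4 : LieAlgd.defect L C hρ j x (a - a') = 0 := by
      refine LieAlgd.defect_eq_zero_of_mem_at L C hρ hJ j ?_
      change a x - a' x ∈ J x
      rw [ha'.self_of_nhds]
      exact (Submodule.Quotient.eq _).1 hsx.symm
    rw [map_sub, h1, sub_zero] at h4
    exact sub_eq_zero.1 h4
  · intro h U hU a ha hpar j hj hjJ x hx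
    obtain ⟨a', ha', -⟩ := LieAlgd.exists_germ hU ha hx
    obtain ⟨j', hj'⟩ := LieAlgd.exists_germ_secIn hU hj hjJ hx
    rw [L.localBracket_eq a' j'.1 ha' hj', L.bracket_swap]
    refine (J x).neg_mem ((Submodule.Quotient.mk_eq_zero _).1 ?_)
    have h1 := congrArg (fun σ : LieAlgd.quotSec E F J => σ.1 x) (h j' a')
    rw [L.bott_quotMk hJ] at h1
    refine h1.trans ?_
    have h2 := hpar (L.anchorIn hρ j').1 (L.anchorIn hρ j').1.contMDiff.contMDiffOn
      (fun y _ => (L.anchorIn hρ j').2 y) x hx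
    rwa [C.localConn_eq (L.anchorIn hρ j') (LieAlgd.quotMk J a')
      (Eventually.of_forall fun _ => rfl) (ha'.mono fun y hy => congrArg (J y).mkQ hy)] at h2
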